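/- Let $n\ge 0$, let $\mathbb S^n$ be the unit sphere of $\mathbb R^{n+1}$, and let $(S_i)_{i\in I}$ be a finite decomposition of $\mathbb R^{n+1}$ in simplicial cones with vertices on $\mathbb S^n$. This means: each $S_i=\{\lambda y : y\in S_i',\ \lambda>0\}$ is the cone over the simplex $S_i'$ whose $n+1$ vertices are linearly independent unit vectors (the vertices of $S_i$); the $S_i$ cover $\mathbb R^{n+1}\setminus\{0\}$; for $i\ne j$ the intersection $S_i\cap S_j$ is the cone over a common proper (possibly empty) face of $S_i'$ and $S_j'$, and the interiors of $S_i$ and $S_j$ are disjoint. Let $p:\mathbb R^{n+1}\to\mathbb R$ be a $C^1$ function that is positively homogeneous of some real degree $d$, i.e. $p(\lambda x)=\lambda^d p(x)$ for all $\lambda>0$ and $x\in\mathbb R^{n+1}$. Let $\tilde p:\mathbb R^{n+1}\to\mathbb R$ be the piecewise linear function whose restriction to each $S_i$ is (the restriction of) the linear form $\tilde p|_{S_i}$ that takes the value $p(v)$ at each vertex $v$ of $S_i$ (and $\tilde p(0)=0$). Put - $V=\{x\in\mathbb S^n : p(x)=0\}$ and $\tilde V=\{x\in\mathbb S^n : \tilde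 p(x)=0\}$, - $\mathbb K(p)=\{x\in\mathbb S^n : p(x)\,\tilde p(x)\le 0\}$, - $G(p,x)=\{\nabla p(x)\}\cup\{\nabla \tilde p|_{S_i}(x) : i\in I,\ x\in S_i\}\subset\mathbb R^{n+1}$. Assume that for every $x\in\mathbb K(p)$ the convex hull of $G(p,x)$ does not contain $0$. Then $V$ and $\tilde V$ are isotopic in $\mathbb S^n$. If moreover the decomposition is stable under $x\mapsto -x$ and $p$ is even or odd (so that $V$ and $\tilde V$ define subsets of projective space), then the images of $V$ and $\tilde V$ in the real projective space $\mathbb P^n(\mathbb R)$ are isotopic in $\mathbb P^n(\mathbb R)$. Here two subsets $A,B$ of a topological space $X$ are called isotopic in $X$ if there is a continuous map $H:[0,1]\times X\to X$ such that every $H(t,\cdot)$ is a homeomorphism of $X$, $H(0,\cdot)$ is the identity, and $H(1,A)=B$. -/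

import Mathlib

open scoped LinearAlgebra.Projectivization

noncomputable section

/-- `ℝⁿ⁺¹` with its Euclidean norm and inner product. -/
abbrev Space (n : ℕ) : Type := EuclideanSpace ℝ (Fin (n + 1))

/-- The unit sphere `Sⁿ` of `ℝⁿ⁺¹`. -/
abbrev UnitSphere (n : ℕ) : Type := Metric.sphere (0 : Space n) 1

/-- The cone `{λ y | y ∈ conv W, λ > 0}` spanned by a finite set `W` of vertices. -/
def coneOver {n : ℕ} (W : Finset (Space n)) : Set (Space n) :=
  {x | ∃ y ∈ convexHull ℝ (W : Set (Space n)), ∃ c : ℝ, 0 < c ∧ x = c • y}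

/-- A decomposition of `ℝⁿ⁺¹` in full-dimensional simplicial cones with vertices on `Sⁿ`.
As cones are taken without their apex, they cover the complement of the origin. -/
structure SimplicialConeDecomposition (n : ℕ) (I : Type*) where
  /-- the vertices of the `i`-th cone -/
  verts : I → Finset (Space n)
  card_verts : ∀ i, (verts i).card = n + 1
  linearIndependent_verts : ∀ i, LinearIndependent ℝ (fun v : verts i => (v : Space n))
  norm_verts : ∀ i, ∀ v ∈ verts i, ‖v‖ = 1
  /-- the cones cover everything but their common apex -/
  iUnion_cone : ⋃ i, coneOver (verts i) = {0}ᶜ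
  /-- two distinct cones meet in a common proper face (possibly the empty one) -/
  inter_cone : ∀ i j, i ≠ j → ∃ F : Finset (Space n), F ⊂ verts i ∧ F ⊂ verts j ∧
    coneOver (verts i) ∩ coneOver (verts j) = coneOver F
  disjoint_interior : ∀ i j, i ≠ j →
    Disjoint (interior (coneOver (verts i))) (interior (coneOver (verts j)))

namespace SimplicialConeDecomposition

variable {n : ℕ} {I : Type*} (D : SimplicialConeDecomposition n I)

/-- The `i`-th cone. -/
def cone (i : I) : Set (Space n) := coneOver (D.verts i)

/-- The decomposition is stable under `x ↦ -x`: the opposite of a cone of the family is a cone of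
the family. A cone is given by its unit vertices, so this is read off from the vertices. -/
def IsSymmetric : Prop :=
  ∀ i, ∃ j, (D.verts j : Set (Space n)) = Neg.neg '' (D.verts i : Set (Space n))

theorem nonempty_verts (i : I) : (D.verts i).Nonempty := by
  rw [← Finset.card_pos, D.card_verts i]
  exact Nat.succ_pos n

/-- The vertices of a cone, as a basis of `ℝⁿ⁺¹`. -/
def basis (i : I) : Module.Basis (D.verts i) ℝ (Space n) :=
  finsetBasisOfLinearIndependentOfCardEqFinrank (D.nonempty_verts i)
    (D.linearIndependent_verts i) (by simp [D.card_verts i])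

/-- The linear form that agrees with `p` at the vertices of the `i`-th cone. -/
def localLinear (p : Space n → ℝ) (i : I) : Space n →ₗ[ℝ] ℝ :=
  (D.basis i).constr ℝ (fun v => p v)

open Classical in
/-- The piecewise linear interpolant of `p`: on each cone it is the linear form that agrees
with `p` at the vertices of that cone (and it vanishes at the origin). -/
def interpolant (p : Space n → ℝ) (x : Space n) : ℝ :=
  if h : ∃ i, x ∈ D.cone i then D.localLinear p h.choose x else 0

theorem localLinear_vertex (p : Space n → ℝ) (i : I) {v : Space n} (hv : v ∈ D.verts i) :
    D.localLinear p i v = p v := by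
  have h := (D.basis i).constr_basis ℝ (fun v : D.verts i => p v) ⟨v, hv⟩
  have h2 : D.basis i ⟨v, hv⟩ = v := by
    simp [basis, finsetBasisOfLinearIndependentOfCardEqFinrank]
  rw [h2] at h
  exact h

/-- The linear forms of two cones agree on their intersection. -/
theorem localLinear_eq_of_mem (p : Space n → ℝ) {i j : I} {x : Space n}
    (hi : x ∈ D.cone i) (hj : x ∈ D.cone j) : D.localLinear p i x = D.localLinear p j x := by
  by_cases hij : i = j
  · rw [hij]
  obtain ⟨F, hFi, hFj, hF⟩ := D.inter_cone i j hij
  have hx : x ∈ coneOver F := hF ▸ ⟨hi, hj⟩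
  obtain ⟨y, hy, c, -, rfl⟩ := hx
  have hy' : y ∈ Submodule.span ℝ (F : Set (Space n)) :=
    convexHull_min Submodule.subset_span (Submodule.convex _) hy
  have h : Set.EqOn (D.localLinear p i) (D.localLinear p j) (F : Set (Space n)) := by
    intro v hv
    rw [D.localLinear_vertex p i (hFi.1 hv), D.localLinear_vertex p j (hFj.1 hv)]
  rw [map_smul, map_smul, LinearMap.eqOn_span h hy']

/-- The interpolant is linear on each cone, with the linear form of that cone. -/
theorem interpolant_of_mem (p : Space n → ℝ) {i : I} {x : Space n} (hx : x ∈ D.cone i) :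
    D.interpolant p x = D.localLinear p i x := by
  have h : ∃ i, x ∈ D.cone i := ⟨i, hx⟩
  rw [interpolant, dif_pos h]
  exact D.localLinear_eq_of_mem p h.choose_spec hx

/-- The set `K(p)` of the points of the sphere where `p` and its interpolant do not have the same
strict sign. -/
def signSet (p : Space n → ℝ) : Set (UnitSphere n) :=
  {x | p x * D.interpolant p x ≤ 0}

/-- The set `G(p, x)`: the gradient of `p` at `x`, and the gradients at `x` of the linear pieces of
the interpolant on all the cones that contain `x`. -/
def gradientSet (p : Space n → ℝ) (x : Space n) : Set (Space n) :=
  {gradient p x} ∪ {g | ∃ i, x ∈ D.cone i ∧ g = gradient (fun y => D.localLinear p i y) x}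

end SimplicialConeDecomposition

/-- The zero locus on the sphere of a function on `ℝⁿ⁺¹`. -/
def zeroLocus {n : ℕ} (f : Space n → ℝ) : Set (UnitSphere n) := {x | f x = 0}

/-- Real projective space carries the quotient topology. -/
instance projectiveTopology (n : ℕ) : TopologicalSpace (ℙ ℝ (Space n)) :=
  inferInstanceAs (TopologicalSpace (Quotient (projectivizationSetoid ℝ (Space n))))

/-- The set of the points of projective space that are represented by points of `A ⊆ Sⁿ`. -/
def projectiveLocus {n : ℕ} (A : Set (UnitSphere n)) : Set (ℙ ℝ (Space n)) :=
  {P | ∃ x ∈ A, ∃ hx : (x : Space n) ≠ 0, P = Projectivization.mk ℝ (x : Space n) hx}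

/-- Two subsets of a topological space are (ambient) isotopic: a continuous family of
homeomorphisms of the space that starts at the identity ends by carrying one onto the other. -/
def Isotopic {X : Type*} [TopologicalSpace X] (A B : Set X) : Prop :=
  ∃ H : unitInterval × X → X, Continuous H ∧
    (∀ t, IsHomeomorph (fun x => H (t, x))) ∧
    (∀ x, H (0, x) = x) ∧
    (fun x => H (1, x)) '' A = B

end

/-! At a point of `K(p)`, separating `0` from the convex hull of the gradients gives a vector along
which `p` and every linear piece of the interpolant there grow faster than unit rate
(`ascentSet_nonempty`). This condition is convex in the vector and open in the point, so a partition
of unity yields a smooth field `ξ` of such vectors (`exists_ascentField`). The tangential part of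
`ξ` generates a flow on the sphere.

Projecting to the sphere can destroy the growth, but not the crossings. A spherical orbit `y` is the
radial projection of a curve `R • y` with velocity `R • ξ`, and by homogeneity `R ^ a * f (y)` has
the sign of `f (y)`. Hence each of the two functions changes sign upwards at each zero and vanishes
at most once on an orbit (`pos_of_lt`, `neg_of_lt`).

An orbit that meets one zero locus also meets the other (`exists_zero`). Otherwise, for all time in
one direction, it would have opposite strict signs of the two functions and so stay in `K(p)`. There
growth of the first scaled function keeps `R` away from `0`, and the second scaled function then
grows at least linearly until it vanishes. The argument needs positive degrees; in degree at most
`0` the function `p` is constant, so the hypothesis forces `K(p)` to be empty and there is nothing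
to move.

Both loci are thus cut by the same orbits, once each, and sliding along orbits, with a cutoff, is
the isotopy (`FlowCrosses.exists_isotopy`). Averaging `ξ` with its antipodal transform makes it
equivariant, so that it descends to projective space. -/

noncomputable section

/-! ### Isotopy along the orbits of a flow -/

section FlowCrossing

open Set Filter Topology

variable {X : Type*} [TopologicalSpace X]

/-- Along every orbit of the flow, `f` changes sign from negative to positive at each zero, and
hence has at most one zero on the orbit. -/
structure FlowCrosses (φ : Flow ℝ X) (f : X → ℝ) : Prop where
  continuous : Continuous f
  pos : ∀ x s, f x = 0 → 0 < s → 0 < f (φ s x)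
  neg : ∀ x s, f x = 0 → s < 0 → f (φ s x) < 0

open Classical in
/-- The time at which the orbit of `x` meets the zero set of `f`, if it does. -/
def crossingTime (φ : Flow ℝ X) (f : X → ℝ) (x : X) : ℝ :=
  if h : ∃ s, f (φ s x) = 0 then h.choose else 0

/-- The union of the orbits that meet the zero set of `f`. -/
def crossingSet (φ : Flow ℝ X) (f : X → ℝ) : Set X := {x | ∃ s, f (φ s x) = 0}

variable {φ : Flow ℝ X} {f g : X → ℝ}

theorem apply_crossingTime {x : X} (hx : x ∈ crossingSet φ f) :
    f (φ (crossingTime φ f x) x) = 0 := by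
  have h : ∃ s, f (φ s x) = 0 := hx
  rw [crossingTime, dif_pos h]
  exact h.choose_spec

theorem mem_crossingSet_flow {x : X} (s : ℝ) :
    φ s x ∈ crossingSet φ f ↔ x ∈ crossingSet φ f := by
  constructor
  · rintro ⟨u, hu⟩
    exact ⟨u + s, by rwa [φ.map_add]⟩
  · rintro ⟨u, hu⟩
    refine ⟨u - s, ?_⟩
    rwa [← φ.map_add, sub_add_cancel]

namespace FlowCrosses

theorem apply_pos (hf : FlowCrosses φ f) {x : X} {s u : ℝ} (h : f (φ s x) = 0) (hu : s < u) :
    0 < f (φ u x) := by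
  have := hf.pos (φ s x) (u - s) h (sub_pos.2 hu)
  rwa [← φ.map_add, sub_add_cancel] at this

theorem apply_neg (hf : FlowCrosses φ f) {x : X} {s u : ℝ} (h : f (φ s x) = 0) (hu : u < s) :
    f (φ u x) < 0 := by
  have := hf.neg (φ s x) (u - s) h (sub_neg.2 hu)
  rwa [← φ.map_add, sub_add_cancel] at this

theorem eq_crossingTime (hf : FlowCrosses φ f) {x : X} {s : ℝ} (h : f (φ s x) = 0) :
    s = crossingTime φ f x := by
  have h' := apply_crossingTime (φ := φ) (f := f) (x := x) ⟨s, h⟩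
  rcases lt_trichotomy s (crossingTime φ f x) with hlt | heq | hgt
  · exact absurd h (hf.apply_neg h' hlt).ne
  · exact heq
  · exact absurd h (hf.apply_pos h' hgt).ne'

theorem crossingTime_flow (hf : FlowCrosses φ f) {x : X} (hx : x ∈ crossingSet φ f) (s : ℝ) :
    crossingTime φ f (φ s x) = crossingTime φ f x - s := by
  symm
  apply hf.eq_crossingTime
  rw [← φ.map_add, sub_add_cancel]
  exact apply_crossingTime hx

/-- The strict signs of `f` at times `ε` before and after the crossing persist for nearby starting
points, so the intermediate value theorem places their crossing in between. -/
theorem eventually_crossing (hf : FlowCrosses φ f) {x : X} (hx : x ∈ crossingSet φ f) {ε : ℝ}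
    (hε : 0 < ε) : ∀ᶠ y in 𝓝 x, y ∈ crossingSet φ f ∧
      |crossingTime φ f y - crossingTime φ f x| ≤ ε := by
  set a := crossingTime φ f x
  have ha : f (φ a x) = 0 := apply_crossingTime hx
  have h1 : ∀ᶠ y in 𝓝 x, 0 < f (φ (a + ε) y) :=
    (hf.continuous.comp (φ.continuous_toFun (a + ε))).continuousAt.eventually
      (lt_mem_nhds (hf.apply_pos ha (by linarith)))
  have h2 : ∀ᶠ y in 𝓝 x, f (φ (a - ε) y) < 0 :=
    (hf.continuous.comp (φ.continuous_toFun (a - ε))).continuousAt.eventually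
      (gt_mem_nhds (hf.apply_neg ha (by linarith)))
  filter_upwards [h1, h2] with y hy1 hy2
  have hc : Continuous fun s => f (φ s y) :=
    hf.continuous.comp (φ.continuous continuous_id continuous_const)
  obtain ⟨s, hs, hs0⟩ := intermediate_value_Icc (by linarith : a - ε ≤ a + ε) hc.continuousOn
    (show (0 : ℝ) ∈ Icc _ _ from ⟨hy2.le, hy1.le⟩)
  refine ⟨⟨s, hs0⟩, ?_⟩
  rw [← hf.eq_crossingTime hs0, abs_le]
  constructor <;> linarith [hs.1, hs.2]

theorem isOpen_crossingSet (hf : FlowCrosses φ f) : IsOpen (crossingSet φ f) := by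
  rw [isOpen_iff_mem_nhds]
  intro x hx
  exact (hf.eventually_crossing hx one_pos).mono fun y hy => hy.1

theorem continuousAt_crossingTime (hf : FlowCrosses φ f) {x : X} (hx : x ∈ crossingSet φ f) :
    ContinuousAt (crossingTime φ f) x := by
  rw [Metric.continuousAt_iff']
  intro ε hε
  filter_upwards [hf.eventually_crossing hx (half_pos hε)] with y hy
  rw [Real.dist_eq]
  linarith [hy.2]

theorem crossingTime_of_eq_zero (hf : FlowCrosses φ f) {x : X} (hx : f x = 0) :
    crossingTime φ f x = 0 := by
  symm
  apply hf.eq_crossingTime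
  rwa [φ.map_zero_apply]

/-- If the zero sets of `f` and `g` are crossed by the same orbits of a flow, then a deformation
along the orbits carries one to the other. The deformation at time `t` flows `x` for the time
`t * τ x`; it commutes with every map that preserves or reverses the flow and preserves the two
zero sets. -/
theorem exists_isotopy [CompactSpace X] [T2Space X] (hf : FlowCrosses φ f) (hg : FlowCrosses φ g)
    (hfg : ∀ x, f x = 0 → x ∈ crossingSet φ g) (hgf : ∀ x, g x = 0 → x ∈ crossingSet φ f) :
    ∃ H : unitInterval × X → X, (Continuous H ∧ (∀ t, IsHomeomorph (fun x => H (t, x))) ∧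
      (∀ x, H (0, x) = x) ∧ (fun x => H (1, x)) '' {x | f x = 0} = {x | g x = 0}) ∧
      ∀ (A : X → X) (ε : ℝ), (ε = 1 ∨ ε = -1) → (∀ s x, φ s (A x) = A (φ (ε * s) x)) →
        (∀ x, f (A x) = 0 ↔ f x = 0) → (∀ x, g (A x) = 0 ↔ g x = 0) →
        ∀ t x, H (t, A x) = A (H (t, x)) := by
  classical
  have hW : crossingSet φ f = crossingSet φ g := by
    ext x
    constructor
    · rintro ⟨s, hs⟩
      exact (mem_crossingSet_flow s).1 (hfg _ hs)
    · rintro ⟨s, hs⟩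
      exact (mem_crossingSet_flow s).1 (hgf _ hs)
  set W := crossingSet φ f with hWdef
  set a := crossingTime φ f
  set b := crossingTime φ g
  have haflow : ∀ x ∈ W, ∀ s, a (φ s x) = a x - s := fun x hx => hf.crossingTime_flow hx
  have hbflow : ∀ x ∈ W, ∀ s, b (φ s x) = b x - s := fun x hx =>
    hg.crossingTime_flow (hW ▸ hx)
  have hTflow : ∀ x ∈ W, ∀ s, b (φ s x) - a (φ s x) = b x - a x := by
    intro x hx s
    rw [haflow x hx, hbflow x hx]
    ring
  have hV : IsCompact {x | f x = 0} :=
    (isClosed_eq hf.continuous continuous_const).isCompact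
  have hcontT : ∀ x ∈ W, ContinuousAt (fun x => b x - a x) x := fun x hx =>
    (hg.continuousAt_crossingTime (hW ▸ hx)).sub (hf.continuousAt_crossingTime hx)
  -- The travel time `b - a` between the two zero sets is constant on orbits, so a bound on the
  -- compact zero set of `f` holds on all of `W`.
  obtain ⟨M, hM⟩ : ∃ M, ∀ x ∈ {x | f x = 0}, ‖b x - a x‖ ≤ M :=
    hV.exists_bound_of_continuousOn fun x hx =>
      (hcontT x ⟨0, by rw [φ.map_zero_apply]; exact hx⟩).continuousWithinAt
  have hM' : ∀ x ∈ W, |b x - a x| ≤ |M| := by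
    intro x hx
    rw [← hTflow x hx (a x)]
    exact (hM _ (apply_crossingTime hx)).trans (le_abs_self M)
  -- Any `L > |M|` would do: the cutoff `ρ` has slope at most `1 / L`, so along an orbit the
  -- displacement varies by a factor less than `1`, which prevents collisions.
  set L : ℝ := 2 * |M| + 1
  have hL : 0 < L := by positivity
  set ρ : ℝ → ℝ := fun s => max 0 (1 - |s| / L)
  have hρ0 : ρ 0 = 1 := by simp [ρ]
  have hρc : Continuous ρ := by fun_prop
  have hρ_le : ∀ s, ρ s ≤ 1 := fun s =>
    max_le zero_le_one (by linarith [div_nonneg (abs_nonneg s) hL.le])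
  have hρ_nn : ∀ s, 0 ≤ ρ s := fun s => le_max_left _ _
  have hρ_lip : ∀ s u, |ρ s - ρ u| ≤ |s - u| / L := by
    intro s u
    simp only [ρ, max_comm (0 : ℝ)]
    refine (abs_max_sub_max_le_abs _ _ _).trans ?_
    have : (1 - |s| / L) - (1 - |u| / L) = (|u| - |s|) / L := by ring
    rw [this, abs_div, abs_of_pos hL]
    rw [abs_sub_comm s u]
    exact div_le_div_of_nonneg_right (abs_abs_sub_abs_le_abs_sub _ _) hL.le
  have hρ_zero : ∀ s, L ≤ |s| → ρ s = 0 := by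
    intro s hs
    refine max_eq_left ?_
    rw [sub_nonpos, one_le_div hL]
    exact hs
  set τ : X → ℝ := fun x => if x ∈ W then (b x - a x) * ρ (a x) else 0
  have hτW : ∀ x ∈ W, τ x = (b x - a x) * ρ (a x) := fun x hx => if_pos hx
  have hτW' : ∀ x, x ∉ W → τ x = 0 := fun x hx => if_neg hx
  have hτc : Continuous τ := by
    rw [continuous_iff_continuousAt]
    intro x
    by_cases hx : x ∈ W
    · have h : ContinuousAt (fun x => (b x - a x) * ρ (a x)) x :=
        (hcontT x hx).mul (hρc.continuousAt.comp (hf.continuousAt_crossingTime hx))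
      refine h.congr ?_
      filter_upwards [hf.isOpen_crossingSet.mem_nhds hx] with y hy
      exact (hτW y hy).symm
    -- Outside `W`, continuity holds because `τ` vanishes off the compact set `C ⊆ W` of points
    -- within time `L` of the zero set of `f`.
    · set C : Set X := (fun q : ℝ × X => φ q.1 q.2) '' (Icc (-L) L ×ˢ {x | f x = 0})
      have hC : IsClosed C :=
        ((isCompact_Icc.prod hV).image (φ.continuous continuous_fst continuous_snd)).isClosed
      have hCW : C ⊆ W := by
        rintro _ ⟨⟨s, y⟩, ⟨-, hy⟩, rfl⟩
        refine (mem_crossingSet_flow s).2 ⟨0, ?_⟩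
        rw [φ.map_zero_apply]
        exact hy
      have h0 : ∀ y ∈ Cᶜ, τ y = 0 := by
        intro y hy
        by_cases hyW : y ∈ W
        · rw [hτW y hyW, hρ_zero, mul_zero]
          by_contra! hlt
          refine hy ⟨(-a y, φ (a y) y), ⟨?_, apply_crossingTime hyW⟩, ?_⟩
          · rw [abs_lt] at hlt
            constructor <;> simp only <;> linarith [hlt.1, hlt.2]
          · simp only
            rw [← φ.map_add, neg_add_cancel, φ.map_zero_apply]
        · exact hτW' y hyW
      have hev : τ =ᶠ[𝓝 x] fun _ => 0 := by
        filter_upwards [hC.isOpen_compl.mem_nhds fun h => hx (hCW h)] with y hy using h0 y hy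
      exact hev.continuousAt
  refine ⟨fun q => φ (q.1 * τ q.2) q.2, ⟨?_, ?_, ?_, ?_⟩, ?_⟩
  · exact φ.continuous ((continuous_subtype_val.comp continuous_fst).mul
      (hτc.comp continuous_snd)) continuous_snd
  · intro t
    have ht0 : (0 : ℝ) ≤ t := t.2.1
    have ht1 : (t : ℝ) ≤ 1 := t.2.2
    rw [isHomeomorph_iff_continuous_bijective]
    refine ⟨φ.continuous (t := fun x => (t : ℝ) * τ x) (by fun_prop) continuous_id, ?_, ?_⟩
    · intro x y hxy
      simp only at hxy
      -- Points with equal images lie on one orbit, `u` apart in time; the Lipschitz bound on `ρ`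
      -- gives `|u| ≤ (|M| / L) * |u|`, hence `u = 0`.
      set u : ℝ := -(t * τ y) + t * τ x with hu
      have hyx : y = φ u x := by
        rw [hu, φ.map_add, hxy, ← φ.map_add, neg_add_cancel, φ.map_zero_apply]
      by_cases hx : x ∈ W
      · have hy : y ∈ W := hyx ▸ (mem_crossingSet_flow u).2 hx
        rw [hτW x hx, hτW y hy, hyx, hTflow x hx, haflow x hx] at hu
        have hu' : u = t * (b x - a x) * (ρ (a x) - ρ (a x - u)) := by
          linear_combination hu
        have h1 : |u| ≤ |M| * (|u| / L) := by
          conv_lhs => rw [hu', abs_mul, abs_mul, abs_of_nonneg ht0]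
          have h2 := hρ_lip (a x) (a x - u)
          rw [sub_sub_cancel] at h2
          calc (t : ℝ) * |b x - a x| * |ρ (a x) - ρ (a x - u)|
              ≤ 1 * |M| * (|u| / L) := mul_le_mul (mul_le_mul ht1 (hM' x hx) (abs_nonneg _)
                zero_le_one) h2 (abs_nonneg _) (by positivity)
            _ = _ := by ring
        have h3 : |u| * L ≤ |M| * |u| := by
          have := mul_le_mul_of_nonneg_right h1 hL.le
          rwa [mul_assoc, div_mul_cancel₀ _ hL.ne'] at this
        have h4 : u = 0 := by
          rw [← abs_eq_zero]
          by_contra hne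
          have hp : 0 < |u| := lt_of_le_of_ne (abs_nonneg _) (Ne.symm hne)
          have : |u| * (|M| + 1) ≤ 0 := by
            simp only [L] at h3
            nlinarith [mul_nonneg hp.le (abs_nonneg M)]
          nlinarith [abs_nonneg M]
        rw [hyx, h4, φ.map_zero_apply]
      · have hy : y ∉ W := fun h => hx ((mem_crossingSet_flow u).1 (hyx ▸ h))
        rw [hyx, hu, hτW' x hx, hτW' y hy]
        simp
    · intro y
      by_cases hy : y ∈ W
      · set T := b y - a y
        have hT := abs_le.1 (hM' y hy)
        -- A preimage of `y` is `φ u y` with `k u = 0`. Since `k` differs from the identity by at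
        -- most `|M|`, it has a zero in `[-|M|, |M|]`.
        set k : ℝ → ℝ := fun u => u + t * (T * ρ (a y - u))
        have hk : Continuous k := by fun_prop
        have hb : ∀ u, |t * (T * ρ (a y - u))| ≤ |M| := by
          intro u
          rw [abs_mul, abs_mul, abs_of_nonneg ht0, abs_of_nonneg (hρ_nn _)]
          calc (t : ℝ) * (|T| * ρ (a y - u)) ≤ 1 * (|M| * 1) :=
                mul_le_mul ht1 (mul_le_mul (hM' y hy) (hρ_le _) (hρ_nn _) (abs_nonneg _))
                  (mul_nonneg (abs_nonneg _) (hρ_nn _)) zero_le_one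
            _ = _ := by ring
        obtain ⟨u, -, hu⟩ := intermediate_value_Icc (by linarith [abs_nonneg M] : -|M| ≤ |M|)
          hk.continuousOn (show (0 : ℝ) ∈ Icc _ _ from
            ⟨by linarith [(abs_le.1 (hb (-|M|))).2], by linarith [(abs_le.1 (hb |M|)).1]⟩)
        refine ⟨φ u y, ?_⟩
        simp only
        rw [hτW _ ((mem_crossingSet_flow u).2 hy), hTflow y hy, haflow y hy,
          ← φ.map_add]
        have : (t : ℝ) * ((b y - a y) * ρ (a y - u)) + u = 0 := by
          rw [← hu]
          simp only [k, T]
          ring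
        rw [this, φ.map_zero_apply]
      · exact ⟨y, by simp only; rw [hτW' y hy, mul_zero, φ.map_zero_apply]⟩
  · intro x
    simp
  · ext y
    constructor
    · rintro ⟨x, hx, rfl⟩
      have hx : f x = 0 := hx
      have hxW : x ∈ W := ⟨0, by rwa [φ.map_zero_apply]⟩
      have ha : a x = 0 := hf.crossingTime_of_eq_zero hx
      change g _ = 0
      simp only [Icc.coe_one]
      rw [one_mul, hτW x hxW, ha, hρ0, mul_one, sub_zero]
      exact apply_crossingTime (hW ▸ hxW)
    · intro hy
      have hy : g y = 0 := hy
      have hyW : y ∈ W := hgf y hy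
      have hb : b y = 0 := hg.crossingTime_of_eq_zero hy
      refine ⟨φ (a y) y, apply_crossingTime hyW, ?_⟩
      simp only [Icc.coe_one]
      rw [one_mul, hτW _ ((mem_crossingSet_flow _).2 hyW), hTflow y hyW, haflow y hyW,
        sub_self, hρ0, hb, ← φ.map_add]
      simp
  · intro A ε hε hA hfA hgA t x
    have hεε : ε * ε = 1 := by rcases hε with rfl | rfl <;> norm_num
    have hmem : A x ∈ W ↔ x ∈ W := by
      constructor
      · rintro ⟨s, hs⟩
        rw [hA, hfA] at hs
        exact ⟨_, hs⟩
      · rintro ⟨s, hs⟩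
        refine ⟨ε * s, ?_⟩
        rwa [hA, hfA, ← mul_assoc, hεε, one_mul]
    have hτA : τ (A x) = ε * τ x := by
      by_cases hx : x ∈ W
      · have haA : a (A x) = ε * a x := by
          symm
          apply hf.eq_crossingTime
          rw [hA, hfA, ← mul_assoc, hεε, one_mul]
          exact apply_crossingTime hx
        have hbA : b (A x) = ε * b x := by
          symm
          apply hg.eq_crossingTime
          rw [hA, hgA, ← mul_assoc, hεε, one_mul]
          exact apply_crossingTime (hW ▸ hx)
        -- The cutoff is even, which is what makes the deformation compatible with maps that reverse
        -- the flow.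
        have hρA : ρ (ε * a x) = ρ (a x) := by
          have : |ε| = 1 := by rcases hε with rfl | rfl <;> simp
          simp only [ρ, abs_mul, this, one_mul]
        rw [hτW _ (hmem.2 hx), hτW x hx, haA, hbA, hρA]
        ring
      · rw [hτW' _ (fun h => hx (hmem.1 h)), hτW' x hx, mul_zero]
    simp only
    rw [hA, hτA]
    congr 2
    linear_combination (t : ℝ) * τ x * hεε

end FlowCrosses

end FlowCrossing

end
-- Global flow of a bounded Lipschitz field
noncomputable section

section GlobalFlow

open Set Filter Topology
open scoped NNReal

variable {E : Type*} [NormedAddCommGroup E] [NormedSpace ℝ E] {F : E → E} {K : ℝ≥0}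

theorem LipschitzWith.integralCurve_unique (hF : LipschitzWith K F) {γ δ : ℝ → E}
    (hγ : ∀ s, HasDerivAt γ (F (γ s)) s) (hδ : ∀ s, HasDerivAt δ (F (δ s)) s)
    (h : γ 0 = δ 0) : γ = δ :=
  ODE_solution_unique_univ (v := fun _ => F) (s := fun _ => univ) (t₀ := 0)
    (fun _ => hF.lipschitzOnWith) (fun s => ⟨hγ s, mem_univ _⟩) (fun s => ⟨hδ s, mem_univ _⟩) h

/-- Grönwall's inequality for positive time; negative time follows by reversing the curves and
negating the field. -/
theorem LipschitzWith.dist_integralCurve_le (hF : LipschitzWith K F) {γ δ : ℝ → E}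
    (hγ : ∀ s, HasDerivAt γ (F (γ s)) s) (hδ : ∀ s, HasDerivAt δ (F (δ s)) s) (s : ℝ) :
    dist (γ s) (δ s) ≤ dist (γ 0) (δ 0) * Real.exp (K * |s|) := by
  have key : ∀ {G : E → E} {γ δ : ℝ → E}, LipschitzWith K G →
      (∀ s, HasDerivAt γ (G (γ s)) s) → (∀ s, HasDerivAt δ (G (δ s)) s) → ∀ s, 0 ≤ s →
      dist (γ s) (δ s) ≤ dist (γ 0) (δ 0) * Real.exp (K * s) := by
    intro G γ δ hG hγ hδ s hs
    have := dist_le_of_trajectories_ODE (v := fun _ => G) (a := 0) (b := s) (fun _ => hG)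
      (fun t _ => (hγ t).continuousAt.continuousWithinAt) (fun t _ => (hγ t).hasDerivWithinAt)
      (fun t _ => (hδ t).continuousAt.continuousWithinAt) (fun t _ => (hδ t).hasDerivWithinAt)
      le_rfl s ⟨hs, le_rfl⟩
    rwa [sub_zero] at this
  rcases le_total 0 s with hs | hs
  · rw [abs_of_nonneg hs]
    exact key hF hγ hδ s hs
  · have hneg : ∀ {γ : ℝ → E}, (∀ s, HasDerivAt γ (F (γ s)) s) →
        ∀ s, HasDerivAt (fun u => γ (-u)) ((-F) (γ (-s))) s := by
      intro γ hγ s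
      simpa [Function.comp_def] using (hγ (-s)).scomp s (hasDerivAt_neg s)
    rw [abs_of_nonpos hs]
    simpa using key hF.neg (hneg hγ) (hneg hδ) (-s) (by linarith)

variable [CompleteSpace E]

theorem LipschitzWith.exists_integralCurve (hF : LipschitzWith K F) {M : ℝ≥0}
    (hM : ∀ x, ‖F x‖ ≤ M) (x : E) :
    ∃ γ : ℝ → E, γ 0 = x ∧ ∀ s, HasDerivAt γ (F (γ s)) s := by
  have hloc : ∀ n : ℕ, ∃ α : ℝ → E, α 0 = x ∧
      ∀ t ∈ Icc (-(n : ℝ)) n, HasDerivWithinAt α (F (α t)) (Icc (-(n : ℝ)) n) t := by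
    intro n
    -- A curve of speed at most `M` stays in the ball of radius `M * n` up to time `n`, so
    -- boundedness of `F` gives existence on the whole interval.
    have hPL : IsPicardLindelof (fun _ => F) (tmin := -(n : ℝ)) (tmax := n)
        ⟨0, by simp⟩ x (M * n) 0 M K :=
      IsPicardLindelof.of_time_independent (fun y _ => hM y) hF.lipschitzOnWith (by simp)
    exact hPL.exists_eq_forall_mem_Icc_hasDerivWithinAt₀
  choose α hα0 hα using hloc
  have hα' : ∀ n : ℕ, ∀ t ∈ Ioo (-(n : ℝ)) n, HasDerivAt (α n) (F (α n t)) t := fun n t ht =>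
    (hα n t (Ioo_subset_Icc_self ht)).hasDerivAt (Icc_mem_nhds ht.1 ht.2)
  have huniq : ∀ n m : ℕ, n ≤ m → ∀ t ∈ Ioo (-(n : ℝ)) n, α n t = α m t := by
    intro n m hnm t ht
    have hn : (0 : ℝ) < n := by linarith [ht.1, ht.2]
    have hnm' : (n : ℝ) ≤ m := by exact_mod_cast hnm
    exact ODE_solution_unique_of_mem_Ioo (v := fun _ => F) (s := fun _ => univ) (t₀ := 0)
      (fun _ _ => hF.lipschitzOnWith) (⟨by linarith, hn⟩ : (0 : ℝ) ∈ Ioo (-(n : ℝ)) n)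
      (fun t ht => ⟨hα' n t ht, mem_univ _⟩)
      (fun t ht => ⟨hα' m t ⟨by linarith [ht.1], by linarith [ht.2]⟩, mem_univ _⟩)
      (by rw [hα0, hα0]) ht
  have hfl : ∀ t : ℝ, t ∈ Ioo (-((⌊|t|⌋₊ + 1 : ℕ) : ℝ)) (⌊|t|⌋₊ + 1 : ℕ) := by
    intro t
    have := Nat.lt_floor_add_one |t|
    push_cast
    exact abs_lt.1 this
  -- The `+ 1` puts `t` in the open interval, where uniqueness lets the local solutions be glued.
  refine ⟨fun t => α (⌊|t|⌋₊ + 1) t, hα0 _, fun s => ?_⟩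
  obtain ⟨N, hN⟩ := exists_nat_gt (|s| + 1)
  have hev : (fun t => α (⌊|t|⌋₊ + 1) t) =ᶠ[𝓝 s] α N := by
    filter_upwards [continuous_abs.continuousAt.eventually (gt_mem_nhds (lt_add_one |s|))]
      with t ht
    refine huniq _ _ ?_ t (hfl t)
    have : ⌊|t|⌋₊ < N := (Nat.floor_lt (abs_nonneg t)).2 (by linarith)
    omega
  have hs : s ∈ Ioo (-(N : ℝ)) N := abs_lt.1 (by linarith)
  simp only [hev.eq_of_nhds]
  exact (hα' N s hs).congr_of_eventuallyEq hev

/-- A bounded Lipschitz vector field generates a global flow. -/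
theorem LipschitzWith.exists_flow (hF : LipschitzWith K F) {M : ℝ≥0} (hM : ∀ x, ‖F x‖ ≤ M) :
    ∃ φ : Flow ℝ E, ∀ x s, HasDerivAt (fun s => φ s x) (F (φ s x)) s := by
  choose γ hγ0 hγ using hF.exists_integralCurve hM
  refine ⟨⟨fun s x => γ x s, ?_, ?_, hγ0⟩, hγ⟩
  · rw [continuous_iff_continuousAt]
    rintro ⟨s, x⟩
    have hc : Continuous (γ x) := continuous_iff_continuousAt.2 fun t => (hγ x t).continuousAt
    refine tendsto_iff_dist_tendsto_zero.2 (squeeze_zero (fun _ => dist_nonneg)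
      (g := fun q : ℝ × E => dist q.2 x * Real.exp (K * |q.1|) + dist (γ x q.1) (γ x s)) ?_ ?_)
    · rintro ⟨t, y⟩
      refine (dist_triangle _ (γ x t) _).trans (add_le_add_left ?_ _)
      simpa [hγ0] using hF.dist_integralCurve_le (hγ y) (hγ x) t
    · have : Continuous fun q : ℝ × E =>
          dist q.2 x * Real.exp (K * |q.1|) + dist (γ x q.1) (γ x s) := by fun_prop
      simpa using this.tendsto (s, x)
  · intro s t x
    have h1 : ∀ u, HasDerivAt (fun u => γ x (u + t)) (F (γ x (u + t))) u := fun u =>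
      (hγ x (u + t)).comp_add_const u t
    exact congrFun (hF.integralCurve_unique h1 (hγ (γ x t)) (by simp [hγ0])) s

end GlobalFlow

end
-- Descent from the sphere to projective space
noncomputable section

section ProjectiveDescent

open Set Filter Topology

variable {n : ℕ}

theorem UnitSphere.coe_ne_zero (x : UnitSphere n) : (x : Space n) ≠ 0 :=
  ne_zero_of_mem_unit_sphere x

/-- The canonical map from the sphere to the projective space. -/
def UnitSphere.toProjective (x : UnitSphere n) : ℙ ℝ (Space n) :=
  Projectivization.mk ℝ (x : Space n) x.coe_ne_zero

/-- The radial projection to the sphere. -/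
def UnitSphere.normalize (v : {v : Space n // v ≠ 0}) : UnitSphere n :=
  ⟨(‖(v : Space n)‖)⁻¹ • (v : Space n), by
    rw [mem_sphere_zero_iff_norm, norm_smul, norm_inv, norm_norm,
      inv_mul_cancel₀ (norm_ne_zero_iff.2 v.2)]⟩

namespace UnitSphere

theorem continuous_normalize : Continuous (normalize (n := n)) := by
  have h : Continuous fun v : {v : Space n // v ≠ 0} => ‖(v : Space n)‖ := by fun_prop
  exact Continuous.subtype_mk
    ((h.inv₀ fun v => norm_ne_zero_iff.2 v.2).smul continuous_subtype_val) _

theorem toProjective_neg (x : UnitSphere n) : toProjective (-x) = toProjective x := by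
  rw [toProjective, toProjective, Projectivization.mk_eq_mk_iff']
  exact ⟨-1, by simp⟩

theorem toProjective_eq_iff {x y : UnitSphere n} :
    toProjective x = toProjective y ↔ x = y ∨ x = -y := by
  constructor
  · intro h
    rw [toProjective, toProjective, Projectivization.mk_eq_mk_iff'] at h
    obtain ⟨a, ha⟩ := h
    have h1 : |a| = 1 := by
      have := congrArg norm ha
      rwa [norm_smul, norm_eq_of_mem_sphere, norm_eq_of_mem_sphere, mul_one,
        Real.norm_eq_abs] at this
    rcases eq_or_eq_neg_of_abs_eq h1 with rfl | rfl
    · left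
      ext1
      rw [← ha, one_smul]
    · right
      ext1
      rw [← ha]
      simp
  · rintro (rfl | rfl)
    · rfl
    · exact toProjective_neg y

theorem toProjective_normalize (v : {v : Space n // v ≠ 0}) :
    toProjective (normalize v) = Projectivization.mk ℝ (v : Space n) v.2 := by
  rw [toProjective, Projectivization.mk_eq_mk_iff']
  exact ⟨_, rfl⟩

/-- The saturation of `U` is `U ∪ -U`. Openness matters because an open quotient map remains one
after a product with the unit interval, as descent of a homotopy requires. -/
theorem isOpenQuotientMap_toProjective : IsOpenQuotientMap (toProjective (n := n)) := by
  have hmk : Continuous fun v : {v : Space n // v ≠ 0} => Projectivization.mk ℝ (v : Space n) v.2 :=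
    continuous_coinduced_rng
  refine ⟨fun P => ?_, ?_, fun U hU => ?_⟩
  · induction P using Projectivization.ind with
    | h v hv => exact ⟨normalize ⟨v, hv⟩, toProjective_normalize ⟨v, hv⟩⟩
  · exact hmk.comp (Continuous.subtype_mk continuous_subtype_val coe_ne_zero)
  · have : (Quotient.mk (projectivizationSetoid ℝ (Space n))) ⁻¹' (toProjective '' U) =
        normalize ⁻¹' (U ∪ -U) := by
      ext v
      change Projectivization.mk ℝ (v : Space n) v.2 ∈ toProjective '' U ↔ _
      rw [← toProjective_normalize, mem_preimage, mem_union, mem_image]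
      constructor
      · rintro ⟨x, hx, h⟩
        rcases toProjective_eq_iff.1 h with rfl | rfl
        · exact Or.inl hx
        · exact Or.inr hx
      · rintro (h | h)
        · exact ⟨_, h, rfl⟩
        · exact ⟨_, h, toProjective_neg _⟩
    have hU' : IsOpen ((Quotient.mk (projectivizationSetoid ℝ (Space n))) ⁻¹'
        (toProjective '' U)) := by
      rw [this]
      exact (hU.union (hU.preimage continuous_neg)).preimage continuous_normalize
    exact isOpen_coinduced.2 hU'

end UnitSphere

theorem projectiveLocus_eq_image (A : Set (UnitSphere n)) :
    projectiveLocus A = UnitSphere.toProjective '' A := by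
  ext P
  constructor
  · rintro ⟨x, hx, hx0, rfl⟩
    exact ⟨x, hx, rfl⟩
  · rintro ⟨x, hx, rfl⟩
    exact ⟨x, hx, x.coe_ne_zero, rfl⟩

/-- An isotopy of the sphere that commutes with the antipodal map descends to projective space. -/
theorem isotopic_projectiveLocus {A B : Set (UnitSphere n)}
    {H : unitInterval × UnitSphere n → UnitSphere n} (hc : Continuous H)
    (hh : ∀ t, IsHomeomorph (fun x => H (t, x))) (h0 : ∀ x, H (0, x) = x)
    (h1 : (fun x => H (1, x)) '' A = B) (hneg : ∀ t x, H (t, -x) = -H (t, x)) :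
    Isotopic (projectiveLocus A) (projectiveLocus B) := by
  have hq := UnitSphere.isOpenQuotientMap_toProjective (n := n)
  choose s hs using hq.surjective
  set H' : unitInterval × ℙ ℝ (Space n) → ℙ ℝ (Space n) := fun q => (H (q.1, s q.2)).toProjective
  have key : ∀ t x, H' (t, x.toProjective) = (H (t, x)).toProjective := by
    intro t x
    rcases UnitSphere.toProjective_eq_iff.1 (hs x.toProjective) with h | h
    · simp only [H', h]
    · simp only [H', h, hneg, UnitSphere.toProjective_neg]
  refine ⟨H', ?_, fun t => ⟨?_, ?_, ?_, ?_⟩, ?_, ?_⟩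
  · have hp : IsOpenQuotientMap (Prod.map (id : unitInterval → unitInterval)
        (UnitSphere.toProjective (n := n))) := IsOpenQuotientMap.id.prodMap hq
    rw [← hp.continuous_comp_iff]
    have : H' ∘ Prod.map id UnitSphere.toProjective = UnitSphere.toProjective ∘ H := by
      ext1 ⟨t, x⟩
      exact key t x
    rw [this]
    exact hq.continuous.comp hc
  · rw [← hq.continuous_comp_iff]
    have : (fun P => H' (t, P)) ∘ UnitSphere.toProjective =
        UnitSphere.toProjective ∘ fun x => H (t, x) := funext (key t)
    rw [this]
    exact hq.continuous.comp (hh t).continuous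
  · rw [hq.isOpenMap_iff]
    have : (fun P => H' (t, P)) ∘ UnitSphere.toProjective =
        UnitSphere.toProjective ∘ fun x => H (t, x) := funext (key t)
    rw [this]
    exact hq.isOpenMap.comp (hh t).isOpenMap
  · intro P Q hPQ
    obtain ⟨x, rfl⟩ := hq.surjective P
    obtain ⟨y, rfl⟩ := hq.surjective Q
    simp only [key] at hPQ
    rw [UnitSphere.toProjective_eq_iff] at hPQ ⊢
    rcases hPQ with h | h
    · exact Or.inl ((hh t).injective h)
    · rw [← hneg] at h
      exact Or.inr ((hh t).injective h)
  · intro P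
    obtain ⟨x, rfl⟩ := hq.surjective P
    obtain ⟨y, rfl⟩ := (hh t).surjective x
    exact ⟨y.toProjective, key t y⟩
  · intro P
    obtain ⟨x, rfl⟩ := hq.surjective P
    rw [key, h0]
  · rw [projectiveLocus_eq_image, projectiveLocus_eq_image, ← h1, image_image, image_image]
    exact image_congr fun x _ => key 1 x

end ProjectiveDescent

end
-- Real functions known through one-sided growth
noncomputable section

section RealCrossing

open Set Filter Topology

/-- Continuous induction: the inequality is a closed condition that propagates to the right. It
replaces the mean value inequality, as the interpolant need not be differentiable. -/
theorem add_mul_le_of_eventually_right {h : ℝ → ℝ} (hc : Continuous h) {c u : ℝ}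
    (hs : ∀ s, u ≤ s → ∀ᶠ t in 𝓝[>] s, h s + c * (t - s) ≤ h t) {s : ℝ} (hus : u ≤ s) :
    h u + c * (s - u) ≤ h s := by
  have hclosed : IsClosed {t | h u + c * (t - u) ≤ h t} := isClosed_le (by fun_prop) hc
  refine (hclosed.inter isClosed_Icc).Icc_subset_of_forall_exists_gt (a := u) (b := s) (by simp) ?_
    (right_mem_Icc.2 hus)
  rintro t ⟨ht, htu, -⟩ z hz
  have ht : h u + c * (t - u) ≤ h t := ht
  obtain ⟨w, hw, hw'⟩ := ((hs t htu).and (Ioc_mem_nhdsGT hz)).exists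
  refine ⟨w, ?_, hw'⟩
  change h u + c * (w - u) ≤ h w
  linarith

/-- At a first return to nonpositive values `h` would vanish with positive values just before,
contrary to `hl`. -/
theorem pos_of_crosses_upwards {h : ℝ → ℝ} (hc : Continuous h)
    (hr : ∀ s, h s = 0 → ∀ᶠ t in 𝓝[>] s, 0 < h t)
    (hl : ∀ s, h s = 0 → ∀ᶠ t in 𝓝[<] s, h t < 0) {s t : ℝ} (hs : h s = 0) (hst : s < t) :
    0 < h t := by
  by_contra! ht
  obtain ⟨u, hu, hsu, hut⟩ := ((hr s hs).and (Ioc_mem_nhdsGT hst)).exists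
  have hA : IsCompact (Icc u t ∩ {w | h w ≤ 0}) :=
    isCompact_Icc.inter_right (isClosed_le hc continuous_const)
  obtain ⟨m, ⟨⟨hum, hmt⟩, hm⟩, hmin⟩ := hA.exists_isLeast ⟨t, ⟨hut, le_rfl⟩, ht⟩
  have hm : h m ≤ 0 := hm
  have hum' : u < m := lt_of_le_of_ne hum fun h => by rw [h] at hu; linarith
  have hpos : ∀ w ∈ Ico u m, 0 < h w := by
    intro w hw
    by_contra! hw0
    exact absurd (hmin ⟨⟨hw.1, hw.2.le.trans hmt⟩, hw0⟩) (not_le.2 hw.2)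
  have hev : ∀ᶠ w in 𝓝[<] m, 0 < h w := by
    filter_upwards [Ico_mem_nhdsLT hum'] with w hw using hpos w hw
  have hm0 : h m = 0 := by
    refine le_antisymm hm ?_
    exact ge_of_tendsto (hc.continuousAt.tendsto.mono_left nhdsWithin_le_nhds)
      (hev.mono fun w hw => hw.le)
  obtain ⟨w, hw1, hw2⟩ := (hev.and (hl m hm0)).exists
  linarith

end RealCrossing

/-! ### Growth along curves on the sphere and their radial lifts -/

section RadialCurves

open Set Filter Topology
open scoped RealInnerProductSpace

variable {E : Type*} [NormedAddCommGroup E] [InnerProductSpace ℝ E]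

/-- `f` grows at least at unit rate at `x` in all directions close to `w`, both before and
after `x`. -/
def AscentAt (f : E → ℝ) (x w : E) : Prop :=
  ∀ᶠ q : ℝ × E in 𝓝[>] 0 ×ˢ 𝓝 w,
    f x + q.1 ≤ f (x + q.1 • q.2) ∧ f (x - q.1 • q.2) ≤ f x - q.1

theorem AscentAt.neg {f : E → ℝ} {x w : E} (h : AscentAt f x w) : AscentAt (-f) x (-w) := by
  have ht : Tendsto (fun q : ℝ × E => (q.1, -q.2)) (𝓝[>] 0 ×ˢ 𝓝 (-w)) (𝓝[>] 0 ×ˢ 𝓝 w) := by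
    refine tendsto_fst.prodMk ?_
    simpa using (tendsto_snd (f := 𝓝[>] (0 : ℝ)) (g := 𝓝 (-w))).neg
  filter_upwards [ht.eventually h] with q hq
  simp only [Pi.neg_apply, smul_neg] at hq ⊢
  rw [sub_neg_eq_add, ← sub_eq_add_neg] at hq
  constructor <;> linarith [hq.1, hq.2]

/-- Here `γ t = γ s + (t - s) • slope γ s t` and the slope tends to `w`; hence the uniformity over
directions near `w` in `AscentAt`. -/
theorem AscentAt.eventually_right {f : E → ℝ} {γ : ℝ → E} {w : E} {s : ℝ}
    (h : AscentAt f (γ s) w) (hγ : HasDerivAt γ w s) :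
    ∀ᶠ t in 𝓝[>] s, f (γ s) + (t - s) ≤ f (γ t) := by
  have h1 : Tendsto (fun t => (t - s, slope γ s t)) (𝓝[>] s) (𝓝[>] 0 ×ˢ 𝓝 w) := by
    refine Tendsto.prodMk ?_ ?_
    · refine tendsto_nhdsWithin_iff.2 ⟨?_, ?_⟩
      · have : Continuous fun t : ℝ => t - s := by fun_prop
        simpa using (this.tendsto s).mono_left nhdsWithin_le_nhds
      · filter_upwards [self_mem_nhdsWithin] with t ht using mem_Ioi.2 (sub_pos.2 (mem_Ioi.1 ht))
    · exact (hasDerivAt_iff_tendsto_slope.1 hγ).mono_left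
        (nhdsWithin_mono _ fun t ht => (mem_Ioi.1 ht).ne')
  filter_upwards [h1.eventually h] with t ht
  have := ht.1
  simpa [sub_smul_slope] using this

theorem AscentAt.eventually_left {f : E → ℝ} {γ : ℝ → E} {w : E} {s : ℝ}
    (h : AscentAt f (γ s) w) (hγ : HasDerivAt γ w s) :
    ∀ᶠ t in 𝓝[<] s, f (γ t) ≤ f (γ s) - (s - t) := by
  have hγ' : HasDerivAt (fun u => γ (-u)) (-w) (-s) := by
    have : HasDerivAt γ w (-(-s)) := by rwa [neg_neg]
    simpa [Function.comp_def] using this.scomp (-s) (hasDerivAt_neg (-s))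
  have h' : AscentAt (-f) ((fun u => γ (-u)) (-s)) (-w) := by
    simpa using h.neg
  have ht : Tendsto (fun t : ℝ => -t) (𝓝[<] s) (𝓝[>] (-s)) := tendsto_neg_nhdsLT
  filter_upwards [ht.eventually (h'.eventually_right (γ := fun u => γ (-u)) hγ')] with t ht
  simp only [Pi.neg_apply, neg_neg] at ht
  linarith

/-- A curve on the unit sphere whose velocity is the tangential part of `v`. -/
structure IsTangentialCurve (y v : ℝ → E) : Prop where
  continuous_field : Continuous v
  norm_eq : ∀ s, ‖y s‖ = 1
  hasDerivAt : ∀ s, HasDerivAt y (v s - ⟪v s, y s⟫ • y s) s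

/-- Positive homogeneity of degree `a`. -/
def PosHomogeneous (f : E → ℝ) (a : ℝ) : Prop := ∀ c : ℝ, 0 < c → ∀ x, f (c • x) = c ^ a * f x

theorem PosHomogeneous.neg {f : E → ℝ} {a : ℝ} (hf : PosHomogeneous f a) :
    PosHomogeneous (-f) a := fun c hc x => by
  simp [hf c hc x]

namespace IsTangentialCurve

variable {y v : ℝ → E} {f g : E → ℝ} {a b : ℝ}

theorem continuous (hy : IsTangentialCurve y v) : Continuous y :=
  continuous_iff_continuousAt.2 fun s => (hy.hasDerivAt s).continuousAt

theorem reverse (hy : IsTangentialCurve y v) :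
    IsTangentialCurve (fun s => y (-s)) (fun s => -v (-s)) where
  continuous_field := by have := hy.continuous_field; fun_prop
  norm_eq s := hy.norm_eq _
  hasDerivAt s := by
    have := (hy.hasDerivAt (-s)).scomp s (hasDerivAt_neg s)
    convert! this using 1
    simp only [inner_neg_left, neg_smul, one_smul]
    abel

theorem continuous_comp (hy : IsTangentialCurve y v)
    (hf : ContinuousOn f (Metric.sphere 0 1)) : Continuous fun s => f (y s) :=
  hf.comp_continuous hy.continuous fun s => by simp [hy.norm_eq s]

/-- There is a positive radial function `R` such that the curve `R • y` has velocity `R • v`. -/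
theorem exists_radius (hy : IsTangentialCurve y v) :
    ∃ R : ℝ → ℝ, (∀ s, 0 < R s) ∧ ∀ s, HasDerivAt R (⟪v s, y s⟫ * R s) s := by
  have hc : Continuous fun s => ⟪v s, y s⟫ := hy.continuous_field.inner hy.continuous
  refine ⟨fun s => Real.exp (∫ t in (0 : ℝ)..s, ⟪v t, y t⟫), fun s => Real.exp_pos _, fun s => ?_⟩
  have h := (intervalIntegral.integral_hasDerivAt_right (hc.intervalIntegrable 0 s)
    (hc.stronglyMeasurableAtFilter _ _) hc.continuousAt).exp
  convert! h using 1
  ring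

variable {R : ℝ → ℝ}

/-- The radial derivative of `R` restores exactly the component `⟪v, y⟫ • y` removed by projection.
Dividing by `R s` makes the lift pass through `y s`, where `AscentAt` is available. -/
theorem hasDerivAt_scaled (hy : IsTangentialCurve y v) (hR : ∀ s, 0 < R s)
    (hR' : ∀ s, HasDerivAt R (⟪v s, y s⟫ * R s) s) (s : ℝ) :
    HasDerivAt (fun t => (R t / R s) • y t) (v s) s := by
  have h := ((hR' s).div_const (R s)).smul (hy.hasDerivAt s)
  convert! h using 1
  rw [div_self (hR s).ne', mul_div_cancel_right₀ _ (hR s).ne', one_smul, sub_add_cancel]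

theorem scaled_apply (hR : ∀ s, 0 < R s) (hf : PosHomogeneous f a) (s t : ℝ) :
    R s ^ a * f ((R t / R s) • y t) = R t ^ a * f (y t) := by
  rw [hf _ (div_pos (hR t) (hR s)), ← mul_assoc, Real.div_rpow (hR t).le (hR s).le,
    mul_div_cancel₀ _ (Real.rpow_pos_of_pos (hR s) a).ne']

theorem eventually_right (hy : IsTangentialCurve y v) (hR : ∀ s, 0 < R s)
    (hR' : ∀ s, HasDerivAt R (⟪v s, y s⟫ * R s) s) (hf : PosHomogeneous f a) {s : ℝ}
    (h : AscentAt f (y s) (v s)) :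
    ∀ᶠ t in 𝓝[>] s, R s ^ a * f (y s) + R s ^ a * (t - s) ≤ R t ^ a * f (y t) := by
  have h1 : (R s / R s) • y s = y s := by rw [div_self (hR s).ne', one_smul]
  have h2 : AscentAt f ((fun t => (R t / R s) • y t) s) (v s) := by
    simp only [h1]
    exact h
  filter_upwards [h2.eventually_right (hy.hasDerivAt_scaled hR hR' s)] with t ht
  rw [h1] at ht
  rw [← scaled_apply hR hf s t, ← mul_add]
  exact mul_le_mul_of_nonneg_left ht (Real.rpow_pos_of_pos (hR s) a).le

theorem eventually_left (hy : IsTangentialCurve y v) (hR : ∀ s, 0 < R s)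
    (hR' : ∀ s, HasDerivAt R (⟪v s, y s⟫ * R s) s) (hf : PosHomogeneous f a) {s : ℝ}
    (h : AscentAt f (y s) (v s)) :
    ∀ᶠ t in 𝓝[<] s, R t ^ a * f (y t) ≤ R s ^ a * f (y s) - R s ^ a * (s - t) := by
  have h1 : (R s / R s) • y s = y s := by rw [div_self (hR s).ne', one_smul]
  have h2 : AscentAt f ((fun t => (R t / R s) • y t) s) (v s) := by
    simp only [h1]
    exact h
  filter_upwards [h2.eventually_left (hy.hasDerivAt_scaled hR hR' s)] with t ht
  rw [h1] at ht
  rw [← scaled_apply hR hf s t, ← mul_sub]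
  exact mul_le_mul_of_nonneg_left ht (Real.rpow_pos_of_pos (hR s) a).le

theorem continuous_scaled (hy : IsTangentialCurve y v) (hR : ∀ s, 0 < R s)
    (hR' : ∀ s, HasDerivAt R (⟪v s, y s⟫ * R s) s)
    (hfc : ContinuousOn f (Metric.sphere 0 1)) : Continuous fun s => R s ^ a * f (y s) :=
  ((continuous_iff_continuousAt.2 fun s => (hR' s).continuousAt).rpow_const
    fun s => Or.inl (hR s).ne').mul (hy.continuous_comp hfc)

theorem pos_of_lt (hy : IsTangentialCurve y v) (hf : PosHomogeneous f a)
    (hfc : ContinuousOn f (Metric.sphere 0 1)) (h : ∀ s, f (y s) = 0 → AscentAt f (y s) (v s))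
    {s t : ℝ} (hs : f (y s) = 0) (hst : s < t) : 0 < f (y t) := by
  obtain ⟨R, hR, hR'⟩ := hy.exists_radius
  have hRa : ∀ s, 0 < R s ^ a := fun s => Real.rpow_pos_of_pos (hR s) a
  have h0 : ∀ s, R s ^ a * f (y s) = 0 → f (y s) = 0 := fun s hs =>
    (mul_eq_zero.1 hs).resolve_left (hRa s).ne'
  refine pos_of_mul_pos_right (a := R t ^ a) (pos_of_crosses_upwards
    (h := fun s => R s ^ a * f (y s)) (hy.continuous_scaled hR hR' hfc) ?_ ?_
    (by rw [hs, mul_zero]) hst) (hRa t).le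
  · intro s hs
    filter_upwards [hy.eventually_right hR hR' hf (h s (h0 s hs)), self_mem_nhdsWithin] with t ht hst
    have := mul_pos (hRa s) (sub_pos.2 hst)
    linarith
  · intro s hs
    filter_upwards [hy.eventually_left hR hR' hf (h s (h0 s hs)), self_mem_nhdsWithin] with t ht hst
    have := mul_pos (hRa s) (sub_pos.2 hst)
    linarith

theorem neg_of_lt (hy : IsTangentialCurve y v) (hf : PosHomogeneous f a)
    (hfc : ContinuousOn f (Metric.sphere 0 1)) (h : ∀ s, f (y s) = 0 → AscentAt f (y s) (v s))
    {s t : ℝ} (hs : f (y s) = 0) (hst : t < s) : f (y t) < 0 := by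
  have := hy.reverse.pos_of_lt (f := -f) hf.neg hfc.neg
    (fun s hs => (h (-s) (neg_eq_zero.1 hs)).neg) (s := -s) (t := -t) (by simp [hs])
    (neg_lt_neg hst)
  simpa using this

variable [ProperSpace E]

/-- If `g` stayed negative, then `f > 0` afterwards, so both functions ascend forever. As `f` is
bounded on the sphere, growth of `R ^ a * f` bounds `R` below, and `R ^ b * g` must reach `0` in
finite time. -/
theorem exists_zero_of_neg (hy : IsTangentialCurve y v) (ha : 0 < a) (hb : 0 < b)
    (hf : PosHomogeneous f a) (hg : PosHomogeneous g b)
    (hfc : ContinuousOn f (Metric.sphere 0 1)) (hgc : ContinuousOn g (Metric.sphere 0 1))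
    (hf' : ∀ s, f (y s) * g (y s) ≤ 0 → AscentAt f (y s) (v s))
    (hg' : ∀ s, f (y s) * g (y s) ≤ 0 → AscentAt g (y s) (v s))
    (hf0 : f (y 0) = 0) (hg0 : g (y 0) < 0) : ∃ s, g (y s) = 0 := by
  by_contra! hne
  obtain ⟨R, hR, hR'⟩ := hy.exists_radius
  have hgy : Continuous fun s => g (y s) := hy.continuous_comp hgc
  have hgneg : ∀ s, g (y s) < 0 := by
    intro s
    by_contra! hs
    obtain ⟨u, -, hu⟩ := intermediate_value_uIcc (a := 0) (b := s) hgy.continuousOn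
      (show (0 : ℝ) ∈ uIcc _ _ from mem_uIcc.2 (Or.inl ⟨hg0.le, hs⟩))
    exact hne u hu
  have hfpos : ∀ s, 0 < s → 0 < f (y s) := fun s hs =>
    hy.pos_of_lt hf hfc (fun s hs => hf' s (by rw [hs, zero_mul])) hf0 hs
  have hK : ∀ s, 1 ≤ s → f (y s) * g (y s) ≤ 0 := fun s hs =>
    mul_nonpos_of_nonneg_of_nonpos (hfpos s (by linarith)).le (hgneg s).le
  have hfmono : ∀ s, 1 ≤ s → R 1 ^ a * f (y 1) ≤ R s ^ a * f (y s) := by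
    intro s hs
    have := add_mul_le_of_eventually_right (c := 0) (hy.continuous_scaled (a := a) hR hR' hfc)
      (fun u hu => by
        filter_upwards [hy.eventually_right hR hR' hf (hf' u (hK u hu)), self_mem_nhdsWithin]
          with t ht hut
        have := mul_pos (Real.rpow_pos_of_pos (hR u) a) (sub_pos.2 hut)
        linarith) hs
    linarith
  obtain ⟨C, hC⟩ := (isCompact_sphere (0 : E) 1).exists_bound_of_continuousOn hfc
  have hC' : ∀ s, f (y s) ≤ C := fun s =>
    (le_abs_self _).trans (hC (y s) (by simp [hy.norm_eq s]))
  have hC0 : 0 < C := (hfpos 1 one_pos).trans_le (hC' 1)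
  -- Time `1` stands for any positive time: `f` vanishes at time `0`, and `δ` must be positive.
  set δ := R 1 ^ a * f (y 1)
  have hδ : 0 < δ := mul_pos (Real.rpow_pos_of_pos (hR 1) a) (hfpos 1 one_pos)
  have hRbound : ∀ s, 1 ≤ s → (δ / C) ^ a⁻¹ ≤ R s := by
    intro s hs
    have h1 : δ / C ≤ R s ^ a := by
      rw [div_le_iff₀ hC0]
      exact (hfmono s hs).trans
        (mul_le_mul_of_nonneg_left (hC' s) (Real.rpow_pos_of_pos (hR s) a).le)
    calc (δ / C) ^ a⁻¹ ≤ (R s ^ a) ^ a⁻¹ :=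
          Real.rpow_le_rpow (div_pos hδ hC0).le h1 (inv_pos.2 ha).le
      _ = R s := Real.rpow_rpow_inv (hR s).le ha.ne'
  set c := ((δ / C) ^ a⁻¹) ^ b
  have hc : 0 < c := Real.rpow_pos_of_pos (Real.rpow_pos_of_pos (div_pos hδ hC0) _) _
  have hcR : ∀ s, 1 ≤ s → c ≤ R s ^ b := fun s hs =>
    Real.rpow_le_rpow (Real.rpow_pos_of_pos (div_pos hδ hC0) _).le (hRbound s hs) hb.le
  have hgrow : ∀ s, 1 ≤ s → R 1 ^ b * g (y 1) + c * (s - 1) ≤ R s ^ b * g (y s) := by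
    intro s hs
    refine add_mul_le_of_eventually_right (hy.continuous_scaled hR hR' hgc) (fun u hu => ?_) hs
    filter_upwards [hy.eventually_right hR hR' hg (hg' u (hK u hu)), self_mem_nhdsWithin]
      with t ht hut
    have := mul_le_mul_of_nonneg_right (hcR u hu) (sub_pos.2 (mem_Ioi.1 hut)).le
    linarith
  set m := R 1 ^ b * g (y 1)
  have hm : m ≤ 0 := mul_nonpos_of_nonneg_of_nonpos (Real.rpow_pos_of_pos (hR 1) b).le (hgneg 1).le
  -- The time at which the linear lower bound reaches `0`.
  have h1 := hgrow (1 + -m / c) (by linarith [div_nonneg (neg_nonneg.2 hm) hc.le])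
  rw [add_sub_cancel_left, mul_div_cancel₀ _ hc.ne', add_neg_cancel] at h1
  exact absurd h1 (not_le.2 (mul_neg_of_pos_of_neg (Real.rpow_pos_of_pos (hR _) b) (hgneg _)))

theorem exists_zero (hy : IsTangentialCurve y v) (ha : 0 < a) (hb : 0 < b)
    (hf : PosHomogeneous f a) (hg : PosHomogeneous g b)
    (hfc : ContinuousOn f (Metric.sphere 0 1)) (hgc : ContinuousOn g (Metric.sphere 0 1))
    (hf' : ∀ s, f (y s) * g (y s) ≤ 0 → AscentAt f (y s) (v s))
    (hg' : ∀ s, f (y s) * g (y s) ≤ 0 → AscentAt g (y s) (v s))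
    (hf0 : f (y 0) = 0) : ∃ s, g (y s) = 0 := by
  rcases lt_trichotomy (g (y 0)) 0 with h | h | h
  · exact hy.exists_zero_of_neg ha hb hf hg hfc hgc hf' hg' hf0 h
  · exact ⟨0, h⟩
  · obtain ⟨s, hs⟩ := hy.reverse.exists_zero_of_neg ha hb hf.neg hg.neg hfc.neg hgc.neg
      (fun s hs => (hf' (-s) (by simpa using hs)).neg)
      (fun s hs => (hg' (-s) (by simpa using hs)).neg) (by simp [hf0]) (by simpa using h)
    exact ⟨-s, by simpa using hs⟩

end IsTangentialCurve

end RadialCurves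

end
-- The tangential flow on the sphere
noncomputable section

section SphereFlow

open Set Filter Topology
open scoped RealInnerProductSpace NNReal

variable {E : Type*} [NormedAddCommGroup E] [InnerProductSpace ℝ E]

/-- A vector field tangent to all spheres centred at the origin, which on the unit sphere is the
tangential part of `ξ`. -/
def tangentialField (ξ : E → E) (x : E) : E := ‖x‖ ^ 2 • ξ x - ⟪ξ x, x⟫ • x

theorem inner_tangentialField (ξ : E → E) (x : E) : ⟪x, tangentialField ξ x⟫ = 0 := by
  rw [tangentialField, inner_sub_right, inner_smul_right, inner_smul_right,
    real_inner_self_eq_norm_sq, real_inner_comm x (ξ x)]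
  ring

theorem tangentialField_of_norm_eq_one (ξ : E → E) {x : E} (hx : ‖x‖ = 1) :
    tangentialField ξ x = ξ x - ⟪ξ x, x⟫ • x := by
  rw [tangentialField, hx, one_pow, one_smul]

theorem tangentialField_neg {ξ : E → E} {σ : ℝ} (h : ∀ x, ξ (-x) = -(σ • ξ x)) (x : E) :
    tangentialField ξ (-x) = -(σ • tangentialField ξ x) := by
  simp only [tangentialField, norm_neg, h, inner_neg_neg, inner_smul_left, smul_sub, smul_neg,
    neg_sub]
  simp [smul_smul, mul_comm σ]
  abel

theorem exists_flow_tangentialField [CompleteSpace E] {ξ : E → E} (hξ : ContDiff ℝ 1 ξ)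
    (hξc : HasCompactSupport ξ) :
    ∃ (K : ℝ≥0) (φ : Flow ℝ E), LipschitzWith K (tangentialField ξ) ∧
      ∀ x s, HasDerivAt (fun s => φ s x) (tangentialField ξ (φ s x)) s := by
  have hd : ContDiff ℝ 1 (tangentialField ξ) :=
    ((contDiff_norm_sq ℝ).smul hξ).sub ((hξ.inner ℝ contDiff_id).smul contDiff_id)
  have hc : HasCompactSupport (tangentialField ξ) := by
    refine hξc.mono' fun x hx => subset_tsupport _ fun h0 => hx ?_
    simp [tangentialField, h0]
  obtain ⟨K, hK⟩ := hd.lipschitzWith_of_hasCompactSupport hc one_ne_zero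
  obtain ⟨M, hM⟩ := hc.exists_bound_of_continuous hd.continuous
  obtain ⟨φ, hφ⟩ := hK.exists_flow (M := M.toNNReal) fun x => (hM x).trans (Real.le_coe_toNNReal M)
  exact ⟨K, φ, hK, hφ⟩

theorem norm_flow_tangentialField {ξ : E → E} {φ : Flow ℝ E}
    (hφ : ∀ x s, HasDerivAt (fun s => φ s x) (tangentialField ξ (φ s x)) s) (s : ℝ) (x : E) :
    ‖φ s x‖ = ‖x‖ := by
  have hd : ∀ t, HasDerivAt (fun t => ‖φ t x‖ ^ 2) 0 t := fun t => by
    have := (hφ x t).norm_sq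
    rwa [inner_tangentialField, mul_zero] at this
  have h := is_const_of_deriv_eq_zero (fun t => (hd t).differentiableAt)
    (fun t => (hd t).deriv) s 0
  simp only [φ.map_zero_apply] at h
  exact (sq_eq_sq₀ (norm_nonneg _) (norm_nonneg _)).1 h

/-- Both sides are integral curves in `s` that start at `-x`. For `σ = -1` the antipodal map
reverses time. -/
theorem flow_tangentialField_neg {ξ : E → E} {K : ℝ≥0} (hK : LipschitzWith K (tangentialField ξ))
    {φ : Flow ℝ E} (hφ : ∀ x s, HasDerivAt (fun s => φ s x) (tangentialField ξ (φ s x)) s)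
    {σ : ℝ} (h : ∀ x, ξ (-x) = -(σ • ξ x)) (s : ℝ) (x : E) :
    φ s (-x) = -φ (σ * s) x := by
  have h1 : ∀ s, HasDerivAt (fun s => -φ (σ * s) x) (tangentialField ξ (-φ (σ * s) x)) s := by
    intro s
    rw [tangentialField_neg h]
    exact ((hφ x (σ * s)).scomp s (by simpa using (hasDerivAt_id s).const_mul σ)).neg
  exact congrFun (hK.integralCurve_unique (hφ (-x)) h1 (by simp)) s

variable {n : ℕ}

/-- Let `ξ` be a vector field along which both `f` and `g` increase at every point of the sphere
where they do not have the same strict sign. Then the zero loci of `f` and `g` on the sphere are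
isotopic, and the isotopy commutes with the antipodal map if `ξ` is even or odd and the zero loci
are symmetric. -/
theorem exists_sphere_isotopy {f g : Space n → ℝ} {a b : ℝ} (ha : 0 < a) (hb : 0 < b)
    (hf : PosHomogeneous f a) (hg : PosHomogeneous g b)
    (hfc : ContinuousOn f (Metric.sphere 0 1)) (hgc : ContinuousOn g (Metric.sphere 0 1))
    {ξ : Space n → Space n} (hξ : ContDiff ℝ 1 ξ) (hξc : HasCompactSupport ξ)
    (hξf : ∀ x, ‖x‖ = 1 → f x * g x ≤ 0 → AscentAt f x (ξ x))
    (hξg : ∀ x, ‖x‖ = 1 → f x * g x ≤ 0 → AscentAt g x (ξ x)) :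
    ∃ H : unitInterval × UnitSphere n → UnitSphere n,
      (Continuous H ∧ (∀ t, IsHomeomorph (fun x => H (t, x))) ∧ (∀ x, H (0, x) = x) ∧
        (fun x => H (1, x)) '' zeroLocus f = zeroLocus g) ∧
      ∀ σ : ℝ, (σ = 1 ∨ σ = -1) → (∀ x, ξ (-x) = -(σ • ξ x)) → (∀ x, f (-x) = 0 ↔ f x = 0) →
        (∀ x, x ≠ 0 → (g (-x) = 0 ↔ g x = 0)) → ∀ t x, H (t, -x) = -H (t, x) := by
  obtain ⟨K, φ, hK, hφ⟩ := exists_flow_tangentialField hξ hξc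
  have hinv : IsInvariant φ (Metric.sphere (0 : Space n) 1) := fun s x hx => by
    rw [mem_sphere_zero_iff_norm] at hx ⊢
    rw [norm_flow_tangentialField hφ, hx]
  set ψ : Flow ℝ (UnitSphere n) := φ.restrict hinv
  have hψ : ∀ s (x : UnitSphere n), ((ψ s x : UnitSphere n) : Space n) = φ s x := fun _ _ => rfl
  have hy : ∀ x : UnitSphere n,
      IsTangentialCurve (fun s => φ s (x : Space n)) (fun s => ξ (φ s (x : Space n))) := by
    intro x
    have hnorm : ∀ s, ‖φ s (x : Space n)‖ = 1 := fun s => by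
      rw [norm_flow_tangentialField hφ, norm_eq_of_mem_sphere]
    refine ⟨hξ.continuous.comp (φ.continuous continuous_id continuous_const), hnorm, fun s => ?_⟩
    have := hφ x s
    rwa [tangentialField_of_norm_eq_one ξ (hnorm s)] at this
  have hcross : ∀ {f : Space n → ℝ} {a : ℝ}, PosHomogeneous f a →
      ContinuousOn f (Metric.sphere 0 1) → (∀ x, ‖x‖ = 1 → f x = 0 → AscentAt f x (ξ x)) →
      FlowCrosses ψ (fun x => f x) := by
    intro f a hf hfc h
    have h' : ∀ (x : UnitSphere n) s, f (φ s (x : Space n)) = 0 →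
        AscentAt f (φ s (x : Space n)) (ξ (φ s (x : Space n))) :=
      fun x s hs => h _ ((hy x).norm_eq s) hs
    refine ⟨hfc.comp_continuous continuous_subtype_val fun x => x.2, fun x s hx hs => ?_,
      fun x s hx hs => ?_⟩
    · rw [hψ]
      exact (hy x).pos_of_lt hf hfc (h' x) (s := 0) (by simpa using hx) hs
    · rw [hψ]
      exact (hy x).neg_of_lt hf hfc (h' x) (s := 0) (by simpa using hx) hs
  have hFf : FlowCrosses ψ (fun x => f x) :=
    hcross hf hfc fun x hx h0 => hξf x hx (by rw [h0, zero_mul])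
  have hFg : FlowCrosses ψ (fun x => g x) :=
    hcross hg hgc fun x hx h0 => hξg x hx (by rw [h0, mul_zero])
  obtain ⟨H, hH, hHneg⟩ := hFf.exists_isotopy hFg
    (fun x hx => (hy x).exists_zero ha hb hf hg hfc hgc (fun s => hξf _ ((hy x).norm_eq s))
      (fun s => hξg _ ((hy x).norm_eq s)) (by simpa using hx))
    (fun x hx => (hy x).exists_zero hb ha hg hf hgc hfc
      (fun s hs => hξg _ ((hy x).norm_eq s) (by rwa [mul_comm]))
      (fun s hs => hξf _ ((hy x).norm_eq s) (by rwa [mul_comm])) (by simpa using hx))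
  refine ⟨H, hH, fun σ hσ hξσ hfσ hgσ => hHneg (fun x => -x) σ hσ (fun s x => ?_)
    (fun x => hfσ x) (fun x => hgσ x x.coe_ne_zero)⟩
  ext1
  simpa [hψ] using flow_tangentialField_neg hK hφ hξσ s x

end SphereFlow

end
-- Local structure of the interpolant and ascent directions
noncomputable section

namespace SimplicialConeDecomposition

open Set Filter Topology
open scoped RealInnerProductSpace

variable {n : ℕ} {I : Type*} (D : SimplicialConeDecomposition n I)

theorem basis_apply (i : I) (v : D.verts i) : D.basis i v = v := by
  simp [basis, finsetBasisOfLinearIndependentOfCardEqFinrank]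

theorem ne_zero_of_mem_cone {i : I} {x : Space n} (hx : x ∈ D.cone i) : x ≠ 0 := by
  have : x ∈ ⋃ i, coneOver (D.verts i) := mem_iUnion.2 ⟨i, hx⟩
  rwa [D.iUnion_cone] at this

theorem exists_mem_cone {x : Space n} (hx : x ≠ 0) : ∃ i, x ∈ D.cone i := by
  have : x ∈ ⋃ i, coneOver (D.verts i) := by rw [D.iUnion_cone]; exact hx
  exact mem_iUnion.1 this

theorem mem_cone_iff {i : I} {x : Space n} :
    x ∈ D.cone i ↔ x ≠ 0 ∧ ∀ v, 0 ≤ (D.basis i).repr x v := by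
  refine ⟨fun hx => ⟨D.ne_zero_of_mem_cone hx, ?_⟩, fun ⟨hx, hv⟩ => ?_⟩
  · obtain ⟨y, hy, c, hc, rfl⟩ := hx
    have hconv : Convex ℝ {z : Space n | ∀ v, 0 ≤ (D.basis i).repr z v} := by
      intro z hz w hw s t hs ht _ v
      simp only [map_add, map_smul, Finsupp.add_apply, Finsupp.smul_apply, smul_eq_mul]
      exact add_nonneg (mul_nonneg hs (hz v)) (mul_nonneg ht (hw v))
    have hsub : ((D.verts i : Finset (Space n)) : Set (Space n)) ⊆
        {z : Space n | ∀ v, 0 ≤ (D.basis i).repr z v} := by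
      intro z hz v
      have : (D.basis i) ⟨z, hz⟩ = z := D.basis_apply i ⟨z, hz⟩
      rw [← this, Module.Basis.repr_self]
      exact Finsupp.single_nonneg.2 zero_le_one v
    intro v
    rw [map_smul, Finsupp.smul_apply, smul_eq_mul]
    exact mul_nonneg hc.le (convexHull_min hsub hconv hy v)
  · set w : D.verts i → ℝ := fun v => (D.basis i).repr x v
    have hsum : ∑ v, w v • (v : Space n) = x := by
      have := (D.basis i).sum_repr x
      simpa only [D.basis_apply] using this
    have hpos : 0 < ∑ v, w v := by
      refine lt_of_le_of_ne (Finset.sum_nonneg fun v _ => hv v) fun h0 => hx ?_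
      have hw := (Finset.sum_eq_zero_iff_of_nonneg fun v _ => hv v).1 h0.symm
      rw [← hsum]
      exact Finset.sum_eq_zero fun v hvm => by rw [show w v = 0 from hw v hvm, zero_smul]
    refine ⟨Finset.univ.centerMass w fun v => (v : Space n), ?_, ∑ v, w v, hpos, ?_⟩
    · exact Finset.centerMass_mem_convexHull _ (fun v _ => hv v) hpos fun v _ => v.2
    · rw [Finset.centerMass, smul_inv_smul₀ hpos.ne', hsum]

theorem smul_mem_cone {i : I} {x : Space n} (hx : x ∈ D.cone i) {c : ℝ} (hc : 0 < c) :
    c • x ∈ D.cone i := by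
  obtain ⟨y, hy, d, hd, rfl⟩ := hx
  exact ⟨y, hy, c * d, mul_pos hc hd, smul_smul c d y⟩

theorem continuous_localLinear (p : Space n → ℝ) (i : I) : Continuous (D.localLinear p i) :=
  (D.localLinear p i).continuous_of_finiteDimensional

/-- A cone missing `x` has a coordinate negative at `x`, hence nearby. Near `x` the interpolant
therefore involves only the linear pieces of cones through `x`. -/
theorem eventually_mem_cone_imp [Finite I] {x : Space n} (hx : x ≠ 0) :
    ∀ᶠ y in 𝓝 x, ∀ i, y ∈ D.cone i → x ∈ D.cone i := by
  rw [eventually_all]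
  intro i
  by_cases hi : x ∈ D.cone i
  · exact Eventually.of_forall fun _ _ => hi
  · have : ∃ v, (D.basis i).repr x v < 0 := by
      by_contra! h
      exact hi (D.mem_cone_iff.2 ⟨hx, h⟩)
    obtain ⟨v, hv⟩ := this
    have hc : Continuous ((D.basis i).coord v) := LinearMap.continuous_of_finiteDimensional _
    filter_upwards [hc.continuousAt.eventually (gt_mem_nhds (show (D.basis i).coord v x < 0 from hv))]
      with y hy hyi
    exact absurd ((D.mem_cone_iff.1 hyi).2 v) (not_le.2 hy)

theorem interpolant_zero (p : Space n → ℝ) : D.interpolant p 0 = 0 := by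
  rw [interpolant, dif_neg]
  rintro ⟨i, hi⟩
  exact D.ne_zero_of_mem_cone hi rfl

theorem posHomogeneous_interpolant (p : Space n → ℝ) : PosHomogeneous (D.interpolant p) 1 := by
  intro c hc x
  rw [Real.rpow_one]
  by_cases hx : x = 0
  · rw [hx, smul_zero, interpolant_zero, mul_zero]
  · obtain ⟨i, hi⟩ := D.exists_mem_cone hx
    rw [D.interpolant_of_mem p hi, D.interpolant_of_mem p (D.smul_mem_cone hi hc), map_smul,
      smul_eq_mul]

theorem continuousAt_interpolant [Finite I] (p : Space n → ℝ) {x : Space n} (hx : x ≠ 0) :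
    ContinuousAt (D.interpolant p) x := by
  rw [Metric.continuousAt_iff']
  intro ε hε
  have h1 : ∀ᶠ y in 𝓝 x, ∀ i, dist (D.localLinear p i y) (D.localLinear p i x) < ε :=
    eventually_all.2 fun i =>
      Metric.continuousAt_iff'.1 (D.continuous_localLinear p i).continuousAt ε hε
  filter_upwards [h1, D.eventually_mem_cone_imp hx, isOpen_ne.mem_nhds hx] with y hy hcone hy0
  obtain ⟨i, hi⟩ := D.exists_mem_cone hy0
  rw [D.interpolant_of_mem p hi, D.interpolant_of_mem p (hcone i hi)]
  exact hy i

theorem continuousOn_interpolant [Finite I] (p : Space n → ℝ) :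
    ContinuousOn (D.interpolant p) (Metric.sphere 0 1) := fun _ hx =>
  (D.continuousAt_interpolant p (ne_zero_of_mem_unit_sphere ⟨_, hx⟩)).continuousWithinAt

variable {D} in
theorem IsSymmetric.exists_neg_cone (hD : D.IsSymmetric) {p : Space n → ℝ} {σ : ℝ}
    (hσ : ∀ x, p (-x) = σ * p x) (i : I) :
    ∃ j, (∀ x, x ∈ D.cone i → -x ∈ D.cone j) ∧
      ∀ x, D.localLinear p j (-x) = σ * D.localLinear p i x := by
  obtain ⟨j, hj⟩ := hD i
  refine ⟨j, ?_, ?_⟩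
  · rintro _ ⟨y, hy, c, hc, rfl⟩
    refine ⟨-y, ?_, c, hc, (smul_neg c y).symm⟩
    rw [hj, image_neg_eq_neg, convexHull_neg]
    simpa using hy
  · intro x
    have : D.localLinear p j ∘ₗ (-LinearMap.id) = σ • D.localLinear p i := by
      refine (D.basis i).ext fun v => ?_
      have hv : -(v : Space n) ∈ D.verts j := by
        rw [← Finset.mem_coe, hj]
        exact ⟨v, v.2, rfl⟩
      simp [D.basis_apply, ← map_neg, D.localLinear_vertex p j hv, D.localLinear_vertex p i v.2, hσ]
    simpa using LinearMap.congr_fun this x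

variable {D} in
theorem IsSymmetric.interpolant_neg (hD : D.IsSymmetric) {p : Space n → ℝ} {σ : ℝ}
    (hσ : ∀ x, p (-x) = σ * p x) (x : Space n) :
    D.interpolant p (-x) = σ * D.interpolant p x := by
  by_cases hx : x = 0
  · rw [hx, neg_zero, interpolant_zero, mul_zero]
  · obtain ⟨i, hi⟩ := D.exists_mem_cone hx
    obtain ⟨j, hj, hl⟩ := hD.exists_neg_cone hσ i
    rw [D.interpolant_of_mem p hi, D.interpolant_of_mem p (hj x hi), hl]

theorem inner_gradient_localLinear (p : Space n → ℝ) (i : I) (x w : Space n) :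
    ⟪gradient (fun y => D.localLinear p i y) x, w⟫ = D.localLinear p i w := by
  have h : HasFDerivAt (fun y => D.localLinear p i y) (D.localLinear p i).toContinuousLinearMap x :=
    (D.localLinear p i).toContinuousLinearMap.hasFDerivAt
  rw [h.hasGradientAt.gradient, InnerProductSpace.toDual_symm_apply]
  rfl

theorem inner_gradient_eq_fderiv (p : Space n → ℝ) (x w : Space n) :
    ⟪gradient p x, w⟫ = fderiv ℝ p x w := by
  rw [gradient, InnerProductSpace.toDual_symm_apply]

/-- The vectors along which both `p` and all the linear pieces of the interpolant at `x` grow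
faster than unit rate. -/
def ascentSet (p : Space n → ℝ) (x : Space n) : Set (Space n) :=
  {w | 1 < fderiv ℝ p x w ∧ ∀ i, x ∈ D.cone i → 1 < D.localLinear p i w}

theorem convex_ascentSet (p : Space n → ℝ) (x : Space n) : Convex ℝ (D.ascentSet p x) := by
  have h1 : Convex ℝ {w : Space n | 1 < fderiv ℝ p x w} :=
    convex_halfSpace_gt (fderiv ℝ p x).toLinearMap.isLinear 1
  have h2 : Convex ℝ (⋂ (i) (_ : x ∈ D.cone i), {w : Space n | 1 < D.localLinear p i w}) :=
    convex_iInter₂ fun i _ => convex_halfSpace_gt (D.localLinear p i).isLinear 1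
  convert! h1.inter h2 using 1
  ext w
  simp [ascentSet]

/-- The hull of finitely many gradients is compact, so a hyperplane separates it strictly from `0`;
its normal vector, rescaled by the separating level `u`, has inner product above `1` with each
gradient. -/
theorem ascentSet_nonempty [Finite I] {p : Space n → ℝ} {x : Space n}
    (h : (0 : Space n) ∉ convexHull ℝ (D.gradientSet p x)) : (D.ascentSet p x).Nonempty := by
  have hfin : (D.gradientSet p x).Finite := by
    refine (finite_singleton _).union ?_
    refine (finite_range fun i => gradient (fun y => D.localLinear p i y) x).subset ?_
    rintro g ⟨i, -, rfl⟩
    exact ⟨i, rfl⟩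
  obtain ⟨f, u, hu0, hu⟩ := geometric_hahn_banach_point_closed (convex_convexHull ℝ _)
    (hfin.isCompact_convexHull (𝕜 := ℝ)).isClosed h
  rw [map_zero] at hu0
  have key : ∀ g ∈ D.gradientSet p x,
      1 < ⟪g, u⁻¹ • (InnerProductSpace.toDual ℝ (Space n)).symm f⟫ := by
    intro g hg
    rw [inner_smul_right, real_inner_comm, InnerProductSpace.toDual_symm_apply,
      inv_mul_eq_div, one_lt_div hu0]
    exact hu g (subset_convexHull ℝ _ hg)
  refine ⟨u⁻¹ • (InnerProductSpace.toDual ℝ (Space n)).symm f, ?_, fun i hi => ?_⟩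
  · rw [← inner_gradient_eq_fderiv]
    exact key _ (Or.inl rfl)
  · rw [← D.inner_gradient_localLinear p i x]
    exact key _ (Or.inr ⟨i, hi, rfl⟩)

theorem eventually_mem_ascentSet [Finite I] {p : Space n → ℝ} (hp : ContDiff ℝ 1 p)
    {x w : Space n} (hx : x ≠ 0) (hw : w ∈ D.ascentSet p x) :
    ∀ᶠ y in 𝓝 x, w ∈ D.ascentSet p y := by
  have hc : Continuous fun y => fderiv ℝ p y w :=
    (hp.continuous_fderiv one_ne_zero).clm_apply continuous_const
  filter_upwards [hc.continuousAt.eventually (lt_mem_nhds hw.1), D.eventually_mem_cone_imp hx]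
    with y hy hcone using ⟨hy, fun i hi => hw.2 i (hcone i hi)⟩

theorem ascentAt_of_hasFDerivAt {f : Space n → ℝ} {f' : Space n →L[ℝ] ℝ} {x w : Space n}
    (hf : HasFDerivAt f f' x) (hw : 1 < f' w) : AscentAt f x w := by
  -- Half of the excess rate covers the variation of the direction, the other half the remainder of
  -- the derivative.
  set c := (f' w - 1) / 2
  have hc : 0 < c := by simp only [c]; linarith
  have hlo := hf.isLittleO.def (c := c / (‖w‖ + 1)) (by positivity)
  have hs : Tendsto (fun q : ℝ × Space n => q.1 • q.2) (𝓝[>] 0 ×ˢ 𝓝 w) (𝓝 0) := by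
    have h1 : Tendsto (fun q : ℝ × Space n => q.1) (𝓝[>] 0 ×ˢ 𝓝 w) (𝓝 0) :=
      tendsto_fst.mono_right nhdsWithin_le_nhds
    simpa using h1.smul (tendsto_snd (f := 𝓝[>] (0 : ℝ)) (g := 𝓝 w))
  have ha : Tendsto (fun q : ℝ × Space n => x + q.1 • q.2) (𝓝[>] 0 ×ˢ 𝓝 w) (𝓝 x) := by
    simpa using hs.const_add x
  have hb : Tendsto (fun q : ℝ × Space n => x - q.1 • q.2) (𝓝[>] 0 ×ˢ 𝓝 w) (𝓝 x) := by
    simpa using hs.const_sub x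
  have hn : ∀ᶠ q : ℝ × Space n in 𝓝[>] 0 ×ˢ 𝓝 w, ‖q.2‖ < ‖w‖ + 1 :=
    (tendsto_snd.norm).eventually (gt_mem_nhds (lt_add_one _))
  have hd : ∀ᶠ q : ℝ × Space n in 𝓝[>] 0 ×ˢ 𝓝 w, 1 + c < f' q.2 :=
    ((f'.continuous.tendsto w).comp tendsto_snd).eventually
      (lt_mem_nhds (by simp only [c]; linarith))
  have hp : ∀ᶠ q : ℝ × Space n in 𝓝[>] 0 ×ˢ 𝓝 w, 0 < q.1 :=
    tendsto_fst.eventually self_mem_nhdsWithin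
  filter_upwards [ha.eventually hlo, hb.eventually hlo, hn, hd, hp] with q h1 h2 h3 h4 h5
  have hbound : c / (‖w‖ + 1) * ‖q.1 • q.2‖ ≤ c * q.1 := by
    rw [norm_smul, Real.norm_of_nonneg h5.le, div_mul_eq_mul_div, div_le_iff₀ (by positivity)]
    have := mul_le_mul_of_nonneg_left h3.le (mul_pos hc h5).le
    linarith
  have h6 := mul_lt_mul_of_pos_left h4 h5
  simp only [add_sub_cancel_left, sub_sub_cancel_left, norm_neg, map_neg, map_smul, smul_eq_mul,
    Real.norm_eq_abs] at h1 h2 hbound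
  have h1' := (abs_le.1 (h1.trans hbound)).1
  have h2' := (abs_le.1 (h2.trans hbound)).2
  constructor <;> linarith

theorem ascentAt_of_mem_ascentSet {p : Space n → ℝ} (hp : ContDiff ℝ 1 p) {x w : Space n}
    (hw : w ∈ D.ascentSet p x) : AscentAt p x w :=
  ascentAt_of_hasFDerivAt (hp.differentiable one_ne_zero x).hasFDerivAt hw.1

/-- A nearby point shares some cone with `x`, and the interpolant is linear there. Which cone does
not matter, since every piece at `x` ascends along `w`. -/
theorem ascentAt_interpolant [Finite I] {p : Space n → ℝ} {x w : Space n} (hx : x ≠ 0)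
    (hw : w ∈ D.ascentSet p x) : AscentAt (D.interpolant p) x w := by
  have hs : Tendsto (fun q : ℝ × Space n => q.1 • q.2) (𝓝[>] 0 ×ˢ 𝓝 w) (𝓝 0) := by
    have h1 : Tendsto (fun q : ℝ × Space n => q.1) (𝓝[>] 0 ×ˢ 𝓝 w) (𝓝 0) :=
      tendsto_fst.mono_right nhdsWithin_le_nhds
    simpa using h1.smul (tendsto_snd (f := 𝓝[>] (0 : ℝ)) (g := 𝓝 w))
  have ha : Tendsto (fun q : ℝ × Space n => x + q.1 • q.2) (𝓝[>] 0 ×ˢ 𝓝 w) (𝓝 x) := by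
    simpa using hs.const_add x
  have hb : Tendsto (fun q : ℝ × Space n => x - q.1 • q.2) (𝓝[>] 0 ×ˢ 𝓝 w) (𝓝 x) := by
    simpa using hs.const_sub x
  have hnear := (D.eventually_mem_cone_imp hx).and (isOpen_ne.mem_nhds hx)
  have hd : ∀ᶠ q : ℝ × Space n in 𝓝[>] 0 ×ˢ 𝓝 w, ∀ i, x ∈ D.cone i →
      1 < D.localLinear p i q.2 := by
    rw [eventually_all]
    intro i
    by_cases hi : x ∈ D.cone i
    · filter_upwards [(((D.continuous_localLinear p i).tendsto w).comp tendsto_snd).eventually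
        (lt_mem_nhds (hw.2 i hi))] with q hq _ using hq
    · exact Eventually.of_forall fun _ h => absurd h hi
  have hp : ∀ᶠ q : ℝ × Space n in 𝓝[>] 0 ×ˢ 𝓝 w, 0 < q.1 :=
    tendsto_fst.eventually self_mem_nhdsWithin
  filter_upwards [ha.eventually hnear, hb.eventually hnear, hd, hp] with q h1 h2 h3 h4
  constructor
  · obtain ⟨i, hi⟩ := D.exists_mem_cone h1.2
    have hxi := h1.1 i hi
    rw [D.interpolant_of_mem p hi, D.interpolant_of_mem p hxi, map_add, map_smul, smul_eq_mul]
    have := mul_lt_mul_of_pos_left (h3 i hxi) h4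
    linarith
  · obtain ⟨i, hi⟩ := D.exists_mem_cone h2.2
    have hxi := h2.1 i hi
    rw [D.interpolant_of_mem p hi, D.interpolant_of_mem p hxi, map_sub, map_smul, smul_eq_mul]
    have := mul_lt_mul_of_pos_left (h3 i hxi) h4
    linarith

end SimplicialConeDecomposition

end
-- Global ascent fields, plain and equivariant, and the theorem
noncomputable section

namespace SimplicialConeDecomposition

open Set Filter Topology
open scoped Manifold ContDiff

variable {n : ℕ} {I : Type*} (D : SimplicialConeDecomposition n I)

/-- A vector that is good at a point stays good nearby, and good vectors form convex sets, so
locally constant choices are glued by a partition of unity. Points off `K(p)` impose no condition.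
-/
theorem exists_ascentField [Finite I] {p : Space n → ℝ} (hp : ContDiff ℝ 1 p)
    (hcond : ∀ x ∈ D.signSet p, (0 : Space n) ∉ convexHull ℝ (D.gradientSet p x)) :
    ∃ ξ : Space n → Space n, ContDiff ℝ 1 ξ ∧ HasCompactSupport ξ ∧
      ∀ x, ‖x‖ = 1 → p x * D.interpolant p x ≤ 0 → ξ x ∈ D.ascentSet p x := by
  obtain ⟨g, hg⟩ := exists_contMDiffMap_forall_mem_convex_of_local_const (n := 1)
    𝓘(ℝ, Space n) (F := Space n)
    (t := fun x => {w | ‖x‖ = 1 → p x * D.interpolant p x ≤ 0 → w ∈ D.ascentSet p x})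
    (fun x => by
      by_cases h : ‖x‖ = 1 ∧ p x * D.interpolant p x ≤ 0
      · simpa [h.1, h.2] using D.convex_ascentSet p x
      · convert! convex_univ (𝕜 := ℝ) (E := Space n)
        exact eq_univ_of_forall fun w h1 h2 => absurd ⟨h1, h2⟩ h)
    (fun x => by
      by_cases h1 : ‖x‖ = 1
      · have hx : x ≠ 0 := norm_ne_zero_iff.1 (by rw [h1]; exact one_ne_zero)
        by_cases h2 : p x * D.interpolant p x ≤ 0
        · obtain ⟨w, hw⟩ := D.ascentSet_nonempty
            (hcond ⟨x, mem_sphere_zero_iff_norm.2 h1⟩ h2)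
          exact ⟨w, (D.eventually_mem_ascentSet hp hx hw).mono fun y hy _ _ => hy⟩
        · refine ⟨0, ?_⟩
          have hc := hp.continuous.continuousAt.mul (D.continuousAt_interpolant p hx)
          filter_upwards [hc.eventually (lt_mem_nhds (not_le.1 h2))] with y hy _ hy'
          exact absurd hy' (not_le.2 hy)
      · refine ⟨0, ?_⟩
        filter_upwards [(continuous_norm.isOpen_preimage _ isOpen_ne).mem_nhds h1] with y hy hy'
        exact absurd hy' hy)
  -- The bump function is `1` on the unit sphere; the compact support makes the flow global.
  let ψ : ContDiffBump (0 : Space n) := ⟨1, 2, one_pos, one_lt_two⟩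
  refine ⟨fun x => ψ x • g x, ψ.contDiff.smul g.contMDiff.contDiff, ψ.hasCompactSupport.smul_right,
    fun x h1 h2 => ?_⟩
  have hψ : ψ x = 1 := ψ.one_of_mem_closedBall (by simpa using h1.le)
  simp only [hψ, one_smul]
  exact hg x h1 h2

variable {D} in
theorem IsSymmetric.neg_smul_mem_ascentSet (hD : D.IsSymmetric) {p : Space n → ℝ}
    (hp : ContDiff ℝ 1 p) {σ : ℝ} (hσ : ∀ x, p (-x) = σ * p x) {x w : Space n}
    (hw : w ∈ D.ascentSet p (-x)) : -(σ • w) ∈ D.ascentSet p x := by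
  constructor
  · have h1 : HasFDerivAt (fun y => p (-y)) (fderiv ℝ p (-x) ∘L (-ContinuousLinearMap.id ℝ _)) x :=
      (hp.differentiable one_ne_zero (-x)).hasFDerivAt.comp x (hasFDerivAt_id x).neg
    have h2 : HasFDerivAt (fun y => σ * p y) (σ • fderiv ℝ p x) x :=
      (hp.differentiable one_ne_zero x).hasFDerivAt.const_mul σ
    rw [show (fun y => p (-y)) = fun y => σ * p y from funext hσ] at h1
    have h3 : fderiv ℝ p (-x) (-w) = σ * fderiv ℝ p x w :=
      congrArg (fun L : Space n →L[ℝ] ℝ => L w) (h1.unique h2)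
    rw [map_neg] at h3
    rw [map_neg, map_smul, smul_eq_mul, ← h3, neg_neg]
    exact hw.1
  · intro i hi
    obtain ⟨j, hj, hl⟩ := hD.exists_neg_cone hσ i
    have := hl w
    rw [map_neg] at this
    rw [map_neg, map_smul, smul_eq_mul, ← this, neg_neg]
    exact hw.2 j (hj x hi)

variable {D} in
theorem IsSymmetric.exists_ascentField [Finite I] (hD : D.IsSymmetric) {p : Space n → ℝ}
    (hp : ContDiff ℝ 1 p)
    (hcond : ∀ x ∈ D.signSet p, (0 : Space n) ∉ convexHull ℝ (D.gradientSet p x)) {σ : ℝ}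
    (hσσ : σ * σ = 1) (hσ : ∀ x, p (-x) = σ * p x) :
    ∃ ξ : Space n → Space n, ContDiff ℝ 1 ξ ∧ HasCompactSupport ξ ∧
      (∀ x, ‖x‖ = 1 → p x * D.interpolant p x ≤ 0 → ξ x ∈ D.ascentSet p x) ∧
      ∀ x, ξ (-x) = -(σ • ξ x) := by
  obtain ⟨ξ, hξ, hξc, hξa⟩ := D.exists_ascentField hp hcond
  -- The average over the antipodal action: both terms lie in the convex set `ascentSet`, and `σ * σ
  -- = 1` gives equivariance.
  refine ⟨fun x => (1 / 2 : ℝ) • ξ x + (1 / 2 : ℝ) • -(σ • ξ (-x)), ?_, ?_, fun x hx h => ?_,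
    fun x => ?_⟩
  · exact (hξ.const_smul (1 / 2 : ℝ)).add
      (((hξ.comp contDiff_neg).const_smul σ).neg.const_smul (1 / 2 : ℝ))
  · have hneg : HasCompactSupport fun x => ξ (-x) := hξc.comp_homeomorph (Homeomorph.neg _)
    exact (hξc.comp_left (g := fun w => (1 / 2 : ℝ) • w) (by simp)).add
      (hneg.comp_left (g := fun w => (1 / 2 : ℝ) • -(σ • w)) (by simp))
  · refine D.convex_ascentSet p x (hξa x hx h) ?_ (by norm_num) (by norm_num) (by norm_num)
    refine hD.neg_smul_mem_ascentSet hp hσ (hξa (-x) (by rwa [norm_neg]) ?_)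
    rw [hσ, hD.interpolant_neg hσ]
    calc σ * p x * (σ * D.interpolant p x) = (σ * σ) * (p x * D.interpolant p x) := by ring
      _ ≤ 0 := by rwa [hσσ, one_mul]
  · simp only [neg_neg, smul_add, smul_neg, neg_add, smul_smul]
    rw [mul_left_comm σ (1 / 2) σ, hσσ, mul_one, mul_comm σ]
    abel

end SimplicialConeDecomposition

/-- As `c` decreases to `0`, the identity `p x = c ^ (-d) * p (c • x)` has a limit independent of
`x`, so `p` is constant. The convention `0 ^ 0 = 1` covers `d = 0`. -/
theorem fderiv_eq_zero_of_degree_nonpos {E : Type*} [NormedAddCommGroup E] [InnerProductSpace ℝ E]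
    {p : E → ℝ} (hp : Continuous p) {d : ℝ} (hd : d ≤ 0) (hhom : PosHomogeneous p d) (x : E) :
    fderiv ℝ p x = 0 := by
  open Filter Topology in
  have hlim : ∀ x, Tendsto (fun c : ℝ => c ^ (-d) * p (c • x)) (𝓝[>] 0) (𝓝 (p x)) := by
    intro x
    refine tendsto_const_nhds.congr' ?_
    filter_upwards [self_mem_nhdsWithin] with c hc
    have hc : 0 < c := hc
    rw [hhom c hc, ← mul_assoc, ← Real.rpow_add hc, neg_add_cancel, Real.rpow_zero, one_mul]
  have hlim' : ∀ x, Tendsto (fun c : ℝ => c ^ (-d) * p (c • x)) (𝓝[>] 0) (𝓝 ((0 : ℝ) ^ (-d) * p 0)) := by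
    intro x
    have h1 : Continuous fun c : ℝ => c ^ (-d) * p (c • x) :=
      (Real.continuous_rpow_const (by linarith)).mul (by fun_prop)
    simpa using (h1.tendsto 0).mono_left nhdsWithin_le_nhds
  have hconst : p = fun _ => (0 : ℝ) ^ (-d) * p 0 :=
    funext fun x => tendsto_nhds_unique (hlim x) (hlim' x)
  rw [hconst, fderiv_const_apply]

theorem isotopic_refl {X : Type*} [TopologicalSpace X] (A : Set X) : Isotopic A A :=
  ⟨Prod.snd, continuous_snd, fun _ => IsHomeomorph.id, fun _ => rfl, Set.image_id A⟩

end

theorem theorem3 {n : ℕ} {I : Type*} [Finite I] (D : SimplicialConeDecomposition n I)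
    (d : ℝ) (p : Space n → ℝ) (hp : ContDiff ℝ 1 p)
    (hhom : ∀ c : ℝ, 0 < c → ∀ x : Space n, p (c • x) = c ^ d * p x)
    (hcond : ∀ x ∈ D.signSet p, (0 : Space n) ∉ convexHull ℝ (D.gradientSet p x)) :
    Isotopic (zeroLocus p) (zeroLocus (D.interpolant p)) ∧
      (D.IsSymmetric → ((∀ x, p (-x) = p x) ∨ (∀ x, p (-x) = -p x)) →
        Isotopic (projectiveLocus (zeroLocus p))
          (projectiveLocus (zeroLocus (D.interpolant p)))) := by
  rcases (D.signSet p).eq_empty_or_nonempty with hK | ⟨x₀, hx₀⟩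
  · have h1 : zeroLocus p = ∅ := Set.eq_empty_of_forall_notMem fun x hx =>
      (Set.eq_empty_iff_forall_notMem.1 hK) x
        (show p x * _ ≤ 0 by rw [show p x = 0 from hx, zero_mul])
    have h2 : zeroLocus (D.interpolant p) = ∅ := Set.eq_empty_of_forall_notMem fun x hx =>
      (Set.eq_empty_iff_forall_notMem.1 hK) x
        (show _ * D.interpolant p x ≤ 0 by rw [show D.interpolant p x = 0 from hx, mul_zero])
    rw [h1, h2]
    exact ⟨isotopic_refl _, fun _ _ => isotopic_refl _⟩
  · have hd : 0 < d := by
      by_contra! hd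
      refine hcond x₀ hx₀ (subset_convexHull ℝ _ (Or.inl ?_))
      rw [Set.mem_singleton_iff, gradient,
        fderiv_eq_zero_of_degree_nonpos hp.continuous hd hhom, map_zero]
    have hmain : ∀ {ξ : Space n → Space n}, ContDiff ℝ 1 ξ → HasCompactSupport ξ →
        (∀ x, ‖x‖ = 1 → p x * D.interpolant p x ≤ 0 → ξ x ∈ D.ascentSet p x) → _ :=
      fun hξ hξc hξa => exists_sphere_isotopy hd one_pos hhom (D.posHomogeneous_interpolant p)
        hp.continuous.continuousOn (D.continuousOn_interpolant p) hξ hξc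
        (fun x hx h => D.ascentAt_of_mem_ascentSet hp (hξa x hx h))
        (fun x hx h => D.ascentAt_interpolant
          (norm_ne_zero_iff.1 (by rw [hx]; exact one_ne_zero)) (hξa x hx h))
    refine ⟨?_, fun hD hpar => ?_⟩
    · obtain ⟨ξ, hξ, hξc, hξa⟩ := D.exists_ascentField hp hcond
      obtain ⟨H, hH, -⟩ := hmain hξ hξc hξa
      exact ⟨H, hH⟩
    · obtain ⟨σ, hσ, hpσ⟩ : ∃ σ : ℝ, (σ = 1 ∨ σ = -1) ∧ ∀ x, p (-x) = σ * p x := by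
        rcases hpar with h | h
        · exact ⟨1, Or.inl rfl, fun x => by rw [h, one_mul]⟩
        · exact ⟨-1, Or.inr rfl, fun x => by rw [h, neg_one_mul]⟩
      have hσσ : σ * σ = 1 := by rcases hσ with rfl | rfl <;> norm_num
      have hσ0 : σ ≠ 0 := fun h => by simp [h] at hσσ
      obtain ⟨ξ, hξ, hξc, hξa, hξσ⟩ := hD.exists_ascentField hp hcond hσσ hpσ
      obtain ⟨H, ⟨hc, hh, h0, h1⟩, hneg⟩ := hmain hξ hξc hξa
      refine isotopic_projectiveLocus hc hh h0 h1 (hneg σ hσ hξσ (fun x => ?_) fun x _ => ?_)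
      · rw [hpσ, mul_eq_zero, or_iff_right hσ0]
      · rw [hD.interpolant_neg hpσ, mul_eq_zero, or_iff_right hσ0]
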